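/- For Borel probability measures $P_1,P_2$ on $\mathbb R^m$ and $\lambda>0$ put $$\ell_\lambda(P_1,P_2)=\inf_{Q\ll P_1}\Big[\tfrac1\lambda\,\mathrm{KL}(Q,P_1)+W_2^2(P_2,Q)\Big],$$ the infimum being over Borel probability measures $Q$ that are absolutely continuous with respect to $P_1$. For $Y_1,\dots,Y_n\in\mathbb R^m$ let $P_n=\frac1n\sum_{j=1}^n\delta_{Y_j}$ and, for $x\in\mathbb R^m$ and $g\in\mathbb R^n$, $$h_1(x,g)=\min_{1\le j\le n}\big(\|x-Y_j\|_2^2-g_j\big)-\tfrac1\lambda\log\Big(\tfrac1n\sum_{t=1}^n e^{-\lambda g_t}\Big).$$ Given samples $X_1,\dots,X_s\in\mathbb R^m$ and $B>0$, stochastic subgradient ascent (SGA) starts at $g_0=0\in\mathbb R^n$ and, for $i=1,\dots,s$, with $\gamma_i=B\sqrt{n/i}$, sets $$g_{i,j}=g_{i-1,j}+\gamma_i\Big(\frac{e^{-\lambda g_{i-1,j}}}{\sum_{l=1}^n e^{-\lambda g_{i-1,l}}}-\mathbf 1(j=j_i^*)\Big),\qquad 1\le j\le n,$$ where $j_i^*$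 is the lowest index minimizing $\|X_i-Y_j\|_2^2-g_{i-1,j}$. The SGA estimate is $$\hat x_{s,B}=\Big(\sum_{i=1}^s\gamma_i\Big)^{-1}\sum_{i=1}^s\gamma_i\,h_1(X_i,g_{i-1}).$$ **Corollary.** Let $n\ge 1$, $\lambda>0$, $0<\varepsilon\le\sqrt n$ and $s=\lceil n\varepsilon^{-2}\rceil$. (a) *Error.* For every $D$ there is a constant $C$, depending only on $D$, such that the following holds for all $m$, $n$, $\lambda$, $\varepsilon$ as above. Let $A\subset\mathbb R^m$ with $0\in A$ and $\sup_{x,y\in A}\|x-y\|_2\le D$, let $Y_1,\dots,Y_n\in A$, let $P$ be a Borel probability measure on $\mathbb R^m$ concentrated on $A$, let $B\in\{D^2,1\}$ with $B>0$, and let $X_1,\dots,X_s$ be i.i.d. with law $P$. Then $\ell_\lambda(P_n,P)<\infty$, $\hat x_{s,B}$ is integrable, and $$\mathbb E\,\big|\hat x_{s,B}-\ell_\lambda(P_n,P)\big|\le C\,\varepsilon\,\big(1+\log(n\varepsilon^{-2})\big).$$ That is, the expected absolute error is $\tilde O(\varepsilon)$, up to a logarithmic factor in $n$ and $1/\varepsilon$.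 (b) *Running time.* On a real random access machine with unit cost for arithmetic operations, $\sqrt{\cdot}$, $\exp$, $\log$, comparisons and memory access, there is a single program that, for all $m,n,\lambda,\varepsilon$ as above, all $B>0$, all $Y_1,\dots,Y_n\in\mathbb R^m$ and all $X_1,\dots,X_s\in\mathbb R^m$, given $m,n,s,\lambda,B$, the points $Y_j$, the samples $X_i$ and the initial position $g_0=0$ as input, computes $\hat x_{s,B}$ and $g_s$ in at most $C_m\,n^2/\varepsilon^2$ steps, where the constant $C_m$ depends only on $m$. -/

import Mathlib

open MeasureTheory ProbabilityTheory
open scoped ENNReal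

namespace RSW

/-- `ℝ^m` with the Euclidean norm. -/
abbrev E (m : ℕ) : Type := EuclideanSpace ℝ (Fin m)

section Divergence

variable {m : ℕ}

/-- The couplings of `P` and `Q`: joint laws whose marginals are `P` and `Q`. -/
def couplings (P Q : Measure (E m)) : Set (Measure (E m × E m)) :=
  {π | π.map Prod.fst = P ∧ π.map Prod.snd = Q}

/-- The Wasserstein-2 distance `(inf over couplings of E ‖A - B‖²)^(1/2)`. -/
noncomputable def W2 (P Q : Measure (E m)) : ℝ≥0∞ :=
  (⨅ π ∈ couplings P Q, ∫⁻ p, ‖p.1 - p.2‖ₑ ^ 2 ∂π) ^ (1 / 2 : ℝ)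

/-- The robust semi-constrained Wasserstein divergence
`ℓ_λ(P₁, P₂) = inf_{Q ≪ P₁} [ (1/λ) KL(Q, P₁) + W₂²(P₂, Q) ]`,
the infimum being over probability measures `Q`. -/
noncomputable def ell (lam : ℝ) (P₁ P₂ : Measure (E m)) : ℝ≥0∞ :=
  ⨅ (Q : Measure (E m)) (_ : IsProbabilityMeasure Q) (_ : Q ≪ P₁),
    (ENNReal.ofReal (1 / lam) * InformationTheory.klDiv Q P₁ + W2 P₂ Q ^ 2)

/-- The empirical measure `∑ j, (1/n) δ_{Y j}`. -/
noncomputable def empirical {n : ℕ} (Y : Fin n → E m) : Measure (E m) :=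
  ∑ j, (n : ℝ≥0∞)⁻¹ • Measure.dirac (Y j)

end Divergence

section Algorithm

variable {m n : ℕ}

/-- `h₁(x, g) = min_j (‖x - Y_j‖² - g_j) - (1/λ) log (∑ t, (1/n) exp (-λ g_t))`. -/
noncomputable def h1 (lam : ℝ) (Y : Fin n → E m) (x : E m) (g : Fin n → ℝ) : ℝ :=
  (⨅ j, (‖x - Y j‖ ^ 2 - g j))
    - (1 / lam) * Real.log (∑ t, (1 / (n : ℝ)) * Real.exp (-lam * g t))

/-- `j` is the lowest index attaining `min_j (‖x - Y_j‖² - g_j)`. -/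
def IsFirstArgmin (Y : Fin n → E m) (x : E m) (g : Fin n → ℝ) (j : Fin n) : Prop :=
  (∀ k, ‖x - Y j‖ ^ 2 - g j ≤ ‖x - Y k‖ ^ 2 - g k) ∧
    ∀ k, k < j → ‖x - Y j‖ ^ 2 - g j < ‖x - Y k‖ ^ 2 - g k

/-- The learning rate `γ_i = B √(n / i)` of iteration `i = 1, 2, …`. -/
noncomputable def rate (n : ℕ) (B : ℝ) (i : ℕ) : ℝ := B * √((n : ℝ) / (i : ℝ))

open scoped Classical in
/-- The update direction `softmax(-λ g)_j - 1(j = j*)`. -/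
noncomputable def direction (lam : ℝ) (Y : Fin n → E m) (x : E m) (g : Fin n → ℝ) :
    Fin n → ℝ := fun j =>
  Real.exp (-lam * g j) / (∑ l, Real.exp (-lam * g l))
    - (if IsFirstArgmin Y x g j then 1 else 0)

/-- The iterates `g_0, g_1, …` of stochastic subgradient ascent.  The samples `X_1, X_2, …` are
`x 0, x 1, …`: iteration `i + 1` uses `x i`. -/
noncomputable def sgaIterate (lam B : ℝ) (Y : Fin n → E m) (g₀ : Fin n → ℝ) (x : ℕ → E m) :
    ℕ → Fin n → ℝ
  | 0 => g₀
  | i + 1 => fun j =>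
      sgaIterate lam B Y g₀ x i j
        + rate n B (i + 1) * direction lam Y (x i) (sgaIterate lam B Y g₀ x i) j

/-- The estimate after `s` iterations,
`(∑_{i=1}^s γ_i)⁻¹ ∑_{i=1}^s γ_i h₁(X_i, g_{i-1})`. -/
noncomputable def sgaEstimate (lam B : ℝ) (Y : Fin n → E m) (g₀ : Fin n → ℝ) (s : ℕ)
    (x : ℕ → E m) : ℝ :=
  (1 / ∑ i ∈ Finset.range s, rate n B (i + 1)) *
    ∑ i ∈ Finset.range s, rate n B (i + 1) * h1 lam Y (x i) (sgaIterate lam B Y g₀ x i)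

end Algorithm

/-! A unit-cost real random access machine, given as a small imperative language over integer
registers, real registers and two-dimensional real arrays. -/

/-- The memory: integer registers, real registers, and named arrays of reals, where
`arr a i k` is the cell of array `a` in row `i` and column `k`. -/
structure Store where
  nat : ℕ → ℕ
  real : ℕ → ℝ
  arr : ℕ → ℕ → ℕ → ℝ

namespace Store

def setNat (σ : Store) (d v : ℕ) : Store := ⟨Function.update σ.nat d v, σ.real, σ.arr⟩

noncomputable def setReal (σ : Store) (d : ℕ) (v : ℝ) : Store :=
  ⟨σ.nat, Function.update σ.real d v, σ.arr⟩

noncomputable def setArr (σ : Store) (a i k : ℕ) (v : ℝ) : Store :=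
  ⟨σ.nat, σ.real, fun a' i' k' => if a' = a ∧ i' = i ∧ k' = k then v else σ.arr a' i' k'⟩

end Store

/-- Programs.  The arguments are names of registers and arrays, except for the literal `q`. -/
inductive Prog : Type
  | skip : Prog
  /-- integer register `d := q` -/
  | natLit (d q : ℕ) : Prog
  /-- integer register `d := a` -/
  | natCopy (d a : ℕ) : Prog
  /-- integer register `d := a + 1` -/
  | natSucc (d a : ℕ) : Prog
  /-- real register `d :=` the value of integer register `a` -/
  | ofNat (d a : ℕ) : Prog
  | copy (d a : ℕ) : Prog
  | add (d a b : ℕ) : Prog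
  | sub (d a b : ℕ) : Prog
  | mul (d a b : ℕ) : Prog
  | div (d a b : ℕ) : Prog
  | sqrt (d a : ℕ) : Prog
  | exp (d a : ℕ) : Prog
  | log (d a : ℕ) : Prog
  /-- real register `d := array t [i, k]`, with `i`, `k` integer registers -/
  | load (d t i k : ℕ) : Prog
  /-- `array t [i, k] :=` real register `a`, with `i`, `k` integer registers -/
  | store (t i k a : ℕ) : Prog
  | seq (p q : Prog) : Prog
  /-- branch on `a < b` for real registers -/
  | ifLt (a b : ℕ) (p q : Prog) : Prog
  /-- branch on `a < b` for integer registers -/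
  | ifNatLt (a b : ℕ) (p q : Prog) : Prog
  /-- for `c = 0, …, N - 1` run `p`, where `N` is the value of integer register `b` on entry -/
  | loop (c b : ℕ) (p : Prog) : Prog

/-- The final memory of a program and its number of steps.  Every elementary instruction, every
test, every entry into a loop and every round of a loop (besides its body) costs one step. -/
noncomputable def Prog.exec : Prog → Store → Store × ℕ
  | .skip => fun σ => (σ, 1)
  | .natLit d q => fun σ => (σ.setNat d q, 1)
  | .natCopy d a => fun σ => (σ.setNat d (σ.nat a), 1)
  | .natSucc d a => fun σ => (σ.setNat d (σ.nat a + 1), 1)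
  | .ofNat d a => fun σ => (σ.setReal d (σ.nat a : ℝ), 1)
  | .copy d a => fun σ => (σ.setReal d (σ.real a), 1)
  | .add d a b => fun σ => (σ.setReal d (σ.real a + σ.real b), 1)
  | .sub d a b => fun σ => (σ.setReal d (σ.real a - σ.real b), 1)
  | .mul d a b => fun σ => (σ.setReal d (σ.real a * σ.real b), 1)
  | .div d a b => fun σ => (σ.setReal d (σ.real a / σ.real b), 1)
  | .sqrt d a => fun σ => (σ.setReal d (√(σ.real a)), 1)
  | .exp d a => fun σ => (σ.setReal d (Real.exp (σ.real a)), 1)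
  | .log d a => fun σ => (σ.setReal d (Real.log (σ.real a)), 1)
  | .load d t i k => fun σ => (σ.setReal d (σ.arr t (σ.nat i) (σ.nat k)), 1)
  | .store t i k a => fun σ => (σ.setArr t (σ.nat i) (σ.nat k) (σ.real a), 1)
  | .seq p q => fun σ =>
      let r₁ := p.exec σ
      let r₂ := q.exec r₁.1
      (r₂.1, r₁.2 + r₂.2)
  | .ifLt a b p q => fun σ =>
      let r := if σ.real a < σ.real b then p.exec σ else q.exec σ
      (r.1, r.2 + 1)
  | .ifNatLt a b p q => fun σ =>
      let r := if σ.nat a < σ.nat b then p.exec σ else q.exec σ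
      (r.1, r.2 + 1)
  | .loop c b p => fun σ =>
      Nat.rec (motive := fun _ => Store × ℕ) (σ, 1)
        (fun k acc =>
          let r := p.exec (acc.1.setNat c k)
          (r.1, acc.2 + r.2 + 1))
        (σ.nat b)

/-- The memory `σ` holds the input of the algorithm: `m`, `n`, `s` in integer registers 0, 1, 2,
`λ` and `B` in real registers 0, 1, and the coordinates of the data, of the `s` samples and of the
initial position in arrays 0, 1, 2.  The rest of the memory is arbitrary. -/
structure HoldsInput {m n : ℕ} (σ : Store) (s : ℕ) (lam B : ℝ) (Y : Fin n → E m)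
    (x : ℕ → E m) (g₀ : Fin n → ℝ) : Prop where
  nat_m : σ.nat 0 = m
  nat_n : σ.nat 1 = n
  nat_s : σ.nat 2 = s
  real_lam : σ.real 0 = lam
  real_B : σ.real 1 = B
  data : ∀ (j : Fin n) (k : Fin m), σ.arr 0 j k = Y j k
  samples : ∀ i < s, ∀ k : Fin m, σ.arr 1 i k = x i k
  init : ∀ j : Fin n, σ.arr 2 j 0 = g₀ j

/-- The memory `σ` holds the output of the algorithm: the estimate in real register 0 and the
final iterate `g_s` in array 2. -/
structure HoldsOutput {m n : ℕ} (σ : Store) (s : ℕ) (lam B : ℝ) (Y : Fin n → E m)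
    (x : ℕ → E m) (g₀ : Fin n → ℝ) : Prop where
  estimate : σ.real 0 = sgaEstimate lam B Y g₀ s x
  final : ∀ j : Fin n, σ.arr 2 j 0 = sgaIterate lam B Y g₀ x s j

/-- The number of iterations `n ε⁻²`, rounded up to an integer. -/
noncomputable def numIter (n : ℕ) (ε : ℝ) : ℕ := ⌈(n : ℝ) / ε ^ 2⌉₊

end RSW

/-! Error. For `X` with law `P`, the map taking `g` to the mean of `h1 lam Y X g` is the concave
semi-dual objective of the problem defining `ell`, and `direction` at a sample is a supergradient of
squared norm at most 2. Ascent from 0 therefore has pathwise regret at most `‖g‖²/2 + ∑ γ_i²`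
against any fixed `g` (`regret_le`). Replacing values at samples by means costs two martingales, one
along the iterates and one at the comparator. Their increments are at most `γ_i D²` wherever the
iterates are, so orthogonality bounds their first moments by `D² √(∑ γ_i²)`
(`integral_abs_sum_h1_sub_le`). Dividing by `∑ γ_i ≥ B √(n s)`, with `∑ γ_i² ≤ B² n (1 + log s)` and
`‖g‖² ≤ n D⁴`, leaves `√(n/s)` up to a logarithm, and `√(n/s) ≤ ε`.

Duality. It remains to see that the supremum over `g` of the mean of `h1` is `ell`. Weak duality
(`integral_h1_le_ell`) is the Donsker–Varadhan inequality plus the elementary transport inequality.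
For the converse, the minimum is smoothed at temperature `η` and the logarithm is replaced by its
argument. The new objective has a maximizer, and there the first-order condition says that the
entropic plan has the empirical measure tilted by `-λ g` as second marginal. Plan and marginal are
feasible for the primal problem, with value within `η log n` of the dual value at `g`
(`exists_ell_le_smooth`). Truncating the potential to `[0, D²]` loses nothing
(`exists_bounded_potential`), whence the bound on `‖g‖²`.

Running time. An iteration scans `n` points at cost `O(m)` each and then updates `n` potentials, and
there are `O(n/ε²)` iterations. Triples with a step count (`Prog.Spec`) verify the output and the
cost together, ending in `sga_spec`. -/

namespace RSW

/-! ### Program logic with a step count. -/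

namespace Prog

/-- Started in a memory satisfying `I`, the program ends after at most `T` steps in a memory
satisfying `J`. -/
def Spec (I : Store → Prop) (p : Prog) (T : ℕ) (J : Store → Prop) : Prop :=
  ∀ σ, I σ → J (p.exec σ).1 ∧ (p.exec σ).2 ≤ T

theorem Spec.seq {I J K : Store → Prop} {p q : Prog} {S T : ℕ} (hp : Spec I p S J)
    (hq : Spec J q T K) : Spec I (.seq p q) (S + T) K := by
  intro σ h
  obtain ⟨h1, h2⟩ := hp σ h
  obtain ⟨h3, h4⟩ := hq _ h1
  exact ⟨h3, Nat.add_le_add h2 h4⟩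

theorem Spec.mono {I I' J J' : Store → Prop} {p : Prog} {S T : ℕ} (hp : Spec I p S J)
    (hI : ∀ σ, I' σ → I σ) (hJ : ∀ σ, J σ → J' σ) (hST : S ≤ T) : Spec I' p T J' := by
  intro σ h
  obtain ⟨h1, h2⟩ := hp σ (hI σ h)
  exact ⟨hJ _ h1, h2.trans hST⟩

/-- A loop of `N` rounds maintains an invariant indexed by the number of finished rounds. -/
theorem Spec.loop {c b N T : ℕ} {p : Prog} (I : ℕ → Store → Prop)
    (hb : ∀ σ, I 0 σ → σ.nat b = N)
    (hp : ∀ k < N, Spec (fun σ => ∃ τ, I k τ ∧ σ = τ.setNat c k) p T (I (k + 1))) :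
    Spec (I 0) (.loop c b p) (1 + N * (T + 1)) (I N) := by
  intro σ h
  simp only [Prog.exec, hb σ h]
  have key : ∀ k ≤ N, I k (Nat.rec (motive := fun _ => Store × ℕ) (σ, 1)
        (fun k acc =>
          let r := p.exec (acc.1.setNat c k)
          (r.1, acc.2 + r.2 + 1)) k).1 ∧
      (Nat.rec (motive := fun _ => Store × ℕ) (σ, 1)
        (fun k acc =>
          let r := p.exec (acc.1.setNat c k)
          (r.1, acc.2 + r.2 + 1)) k).2 ≤ 1 + k * (T + 1) := by
    intro k
    induction k with
    | zero => intro _; simpa using h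
    | succ k ih =>
      intro hk
      obtain ⟨h1, h2⟩ := ih (by omega)
      obtain ⟨h3, h4⟩ := hp k (by omega) _ ⟨_, h1, rfl⟩
      refine ⟨h3, ?_⟩
      simp only at h2 h4 ⊢
      rw [Nat.add_mul, one_mul]
      omega
  exact key N le_rfl

end Prog
end RSW

namespace RSW

/-! ### Concavity of `h1` and the pathwise regret of subgradient ascent. -/

section Deterministic

variable {m n : ℕ}

theorem exists_isFirstArgmin (hn : 0 < n) (Y : Fin n → E m) (x : E m) (g : Fin n → ℝ) :
    ∃ j, IsFirstArgmin Y x g j := by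
  classical
  have : Nonempty (Fin n) := ⟨⟨0, hn⟩⟩
  obtain ⟨j₀, hj₀⟩ := Finite.exists_min (fun j => ‖x - Y j‖ ^ 2 - g j)
  let S : Finset (Fin n) :=
    Finset.univ.filter fun j => ∀ k, ‖x - Y j‖ ^ 2 - g j ≤ ‖x - Y k‖ ^ 2 - g k
  have hS : S.Nonempty := ⟨j₀, by simpa [S] using hj₀⟩
  refine ⟨S.min' hS, ?_, ?_⟩
  · have := S.min'_mem hS
    simpa [S] using this
  · intro k hk
    have h1 : ∀ k, ‖x - Y (S.min' hS)‖ ^ 2 - g (S.min' hS) ≤ ‖x - Y k‖ ^ 2 - g k := by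
      have := S.min'_mem hS
      simpa [S] using this
    refine lt_of_le_of_ne (h1 k) fun h => ?_
    have hkS : k ∈ S := by
      simp only [S, Finset.mem_filter, Finset.mem_univ, true_and]
      intro l
      rw [← h]
      exact h1 l
    exact absurd (S.min'_le k hkS) (not_le.2 hk)

theorem IsFirstArgmin.unique {Y : Fin n → E m} {x : E m} {g : Fin n → ℝ} {j k : Fin n}
    (hj : IsFirstArgmin Y x g j) (hk : IsFirstArgmin Y x g k) : j = k := by
  rcases lt_trichotomy j k with h | h | h
  · exact absurd (hk.2 j h) (not_lt.2 (hj.1 k))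
  · exact h
  · exact absurd (hj.2 k h) (not_lt.2 (hk.1 j))

theorem IsFirstArgmin.iInf_eq {Y : Fin n → E m} {x : E m} {g : Fin n → ℝ} {j : Fin n}
    (hj : IsFirstArgmin Y x g j) : ⨅ k, (‖x - Y k‖ ^ 2 - g k) = ‖x - Y j‖ ^ 2 - g j := by
  have : Nonempty (Fin n) := ⟨j⟩
  exact le_antisymm (ciInf_le (Set.finite_range _).bddBelow j) (le_ciInf hj.1)

theorem IsFirstArgmin.ite_eq {Y : Fin n → E m} {x : E m} {g : Fin n → ℝ} {j : Fin n}
    (hj : IsFirstArgmin Y x g j) (lam : ℝ) (k : Fin n) :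
    direction lam Y x g k = Real.exp (-lam * g k) / (∑ l, Real.exp (-lam * g l))
      - (if k = j then 1 else 0) := by
  unfold direction
  by_cases h : k = j
  · simp [h, hj]
  · have : ¬ IsFirstArgmin Y x g k := fun hk => h (hk.unique hj)
    simp [h, this]

theorem sum_exp_pos (hn : 0 < n) (lam : ℝ) (g : Fin n → ℝ) :
    0 < ∑ l, Real.exp (-lam * g l) := by
  have : Nonempty (Fin n) := ⟨⟨0, hn⟩⟩
  exact Finset.sum_pos (fun _ _ => Real.exp_pos _) Finset.univ_nonempty

/-- The log-partition term of `h1`. -/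
noncomputable def logMean (lam : ℝ) (g : Fin n → ℝ) : ℝ :=
  (1 / lam) * Real.log (∑ t, (1 / (n : ℝ)) * Real.exp (-lam * g t))

theorem h1_eq (lam : ℝ) (Y : Fin n → E m) (x : E m) (g : Fin n → ℝ) :
    h1 lam Y x g = (⨅ j, (‖x - Y j‖ ^ 2 - g j)) - logMean lam g := rfl

/-- This is the gradient inequality of the convex function `logMean`, whose gradient is minus the
softmax vector. It is Jensen's inequality for `exp` with the softmax weights, since averaging `exp
(-λ (g' - g))` under them gives the ratio of the two partition sums. -/
theorem logMean_sub_le (hn : 0 < n) {lam : ℝ} (hl : 0 < lam) (g g' : Fin n → ℝ) :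
    logMean lam g - logMean lam g' ≤
      ∑ j, Real.exp (-lam * g j) / (∑ l, Real.exp (-lam * g l)) * (g' j - g j) := by
  have hS := sum_exp_pos hn lam g
  have hS' := sum_exp_pos hn lam g'
  set S := ∑ l, Real.exp (-lam * g l) with hSdef
  set S' := ∑ l, Real.exp (-lam * g' l) with hSdef'
  have hn' : (0 : ℝ) < n := by exact_mod_cast hn
  have key : ∑ j, Real.exp (-lam * g j) / S * (-lam * (g' j - g j)) ≤ Real.log (S' / S) := by
    rw [Real.le_log_iff_exp_le (by positivity)]
    have := convexOn_exp.map_sum_le (t := Finset.univ)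
      (w := fun j => Real.exp (-lam * g j) / S) (p := fun j => -lam * (g' j - g j))
      (fun _ _ => by positivity) (by rw [← Finset.sum_div]; exact div_self hS.ne')
      (fun _ _ => Set.mem_univ _)
    simp only [smul_eq_mul] at this
    refine this.trans (le_of_eq ?_)
    rw [hSdef', Finset.sum_div]
    refine Finset.sum_congr rfl fun j _ => ?_
    rw [div_mul_eq_mul_div, ← Real.exp_add]
    ring_nf
  have e1 : logMean lam g - logMean lam g' = -(1 / lam) * Real.log (S' / S) := by
    unfold logMean
    rw [← Finset.mul_sum, ← Finset.mul_sum, Real.log_mul (by positivity) hS.ne',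
      Real.log_mul (by positivity) hS'.ne', Real.log_div hS'.ne' hS.ne']
    ring
  have e2 : ∑ j, Real.exp (-lam * g j) / S * (-lam * (g' j - g j)) =
      -lam * ∑ j, Real.exp (-lam * g j) / S * (g' j - g j) := by
    rw [Finset.mul_sum]
    exact Finset.sum_congr rfl fun j _ => by ring
  rw [e2] at key
  rw [e1]
  have := mul_le_mul_of_nonneg_left key (by positivity : 0 ≤ 1 / lam)
  have e3 : 1 / lam * (-lam * ∑ j, Real.exp (-lam * g j) / S * (g' j - g j)) =
      - ∑ j, Real.exp (-lam * g j) / S * (g' j - g j) := by field_simp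
  rw [e3] at this
  linarith

/-- `direction` is a supergradient of the concave function `h1 lam Y x`. -/
theorem h1_sub_le (hn : 0 < n) {lam : ℝ} (hl : 0 < lam) (Y : Fin n → E m) (x : E m)
    (g g' : Fin n → ℝ) :
    h1 lam Y x g' - h1 lam Y x g ≤ ∑ j, direction lam Y x g j * (g' j - g j) := by
  obtain ⟨j, hj⟩ := exists_isFirstArgmin hn Y x g
  simp only [hj.ite_eq, sub_mul, Finset.sum_sub_distrib, ite_mul, one_mul, zero_mul,
    Finset.sum_ite_eq', Finset.mem_univ, if_true]
  rw [h1_eq, h1_eq, hj.iInf_eq]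
  have h2 : ⨅ k, (‖x - Y k‖ ^ 2 - g' k) ≤ ‖x - Y j‖ ^ 2 - g' j :=
    ciInf_le (Set.finite_range _).bddBelow j
  have := logMean_sub_le hn hl g g'
  simp only [mul_sub, Finset.sum_sub_distrib] at this ⊢
  linarith

/-- The direction is a difference `p - e` of two probability vectors, and entries in `[0, 1]`
satisfy `(p_k - e_k)² ≤ p_k + e_k`. -/
theorem sum_direction_sq_le (hn : 0 < n) (lam : ℝ) (Y : Fin n → E m) (x : E m)
    (g : Fin n → ℝ) : ∑ j, direction lam Y x g j ^ 2 ≤ 2 := by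
  obtain ⟨j, hj⟩ := exists_isFirstArgmin hn Y x g
  have hS := sum_exp_pos hn lam g
  have hle : ∀ k, direction lam Y x g k ^ 2 ≤
      Real.exp (-lam * g k) / (∑ l, Real.exp (-lam * g l)) + (if k = j then 1 else 0) := by
    intro k
    rw [hj.ite_eq]
    have h0 : 0 ≤ Real.exp (-lam * g k) / (∑ l, Real.exp (-lam * g l)) := by positivity
    have h1 : Real.exp (-lam * g k) / (∑ l, Real.exp (-lam * g l)) ≤ 1 := by
      rw [div_le_one hS]
      exact Finset.single_le_sum (f := fun l => Real.exp (-lam * g l))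
        (fun _ _ => (Real.exp_pos _).le) (Finset.mem_univ k)
    split_ifs <;> nlinarith
  refine (Finset.sum_le_sum fun k _ => hle k).trans (le_of_eq ?_)
  rw [Finset.sum_add_distrib, ← Finset.sum_div, div_self hS.ne']
  simp
  norm_num

/-- Pathwise regret bound of subgradient ascent started at `0`. -/
theorem regret_le (hn : 0 < n) {lam B : ℝ} (hl : 0 < lam) (hB : 0 < B) (Y : Fin n → E m)
    (x : ℕ → E m) (g : Fin n → ℝ) (s : ℕ) :
    ∑ i ∈ Finset.range s, rate n B (i + 1) *
        (h1 lam Y (x i) g - h1 lam Y (x i) (sgaIterate lam B Y 0 x i)) ≤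
      (∑ j, g j ^ 2) / 2 + ∑ i ∈ Finset.range s, rate n B (i + 1) ^ 2 := by
  -- Half the squared distance to the comparator is kept on the left so that the induction
  -- telescopes. Expanding the square in one step produces the supergradient pairing and the squared
  -- norm of the direction, whose bound 2 cancels the factor 1/2.
  suffices h : ∑ i ∈ Finset.range s, rate n B (i + 1) *
        (h1 lam Y (x i) g - h1 lam Y (x i) (sgaIterate lam B Y 0 x i)) +
      (∑ j, (g j - sgaIterate lam B Y 0 x s j) ^ 2) / 2 ≤
      (∑ j, g j ^ 2) / 2 + ∑ i ∈ Finset.range s, rate n B (i + 1) ^ 2 by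
    have : 0 ≤ ∑ j, (g j - sgaIterate lam B Y 0 x s j) ^ 2 :=
      Finset.sum_nonneg fun _ _ => sq_nonneg _
    linarith
  induction s with
  | zero => simp [sgaIterate]
  | succ s ih =>
    rw [Finset.sum_range_succ, Finset.sum_range_succ]
    set u := sgaIterate lam B Y 0 x s with hu
    have hr : 0 ≤ rate n B (s + 1) := by unfold rate; positivity
    have e : ∑ j, (g j - sgaIterate lam B Y 0 x (s + 1) j) ^ 2 =
        ∑ j, (g j - u j) ^ 2 - 2 * rate n B (s + 1) * ∑ j, direction lam Y (x s) u j * (g j - u j)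
          + rate n B (s + 1) ^ 2 * ∑ j, direction lam Y (x s) u j ^ 2 := by
      rw [Finset.mul_sum, Finset.mul_sum, ← Finset.sum_sub_distrib, ← Finset.sum_add_distrib]
      refine Finset.sum_congr rfl fun j _ => ?_
      simp only [sgaIterate, ← hu]
      ring
    have h1 := mul_le_mul_of_nonneg_left (h1_sub_le hn hl Y (x s) u g) hr
    have h2 := mul_le_mul_of_nonneg_left (sum_direction_sq_le hn lam Y (x s) u)
      (sq_nonneg (rate n B (s + 1)))
    rw [e]
    linarith

theorem iInf_cost_sub_le (hn : 0 < n) {Y : Fin n → E m} {x y : E m} {R : ℝ}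
    (h : ∀ j, ‖x - Y j‖ ^ 2 ≤ ‖y - Y j‖ ^ 2 + R) (g : Fin n → ℝ) :
    ⨅ j, (‖x - Y j‖ ^ 2 - g j) ≤ (⨅ j, (‖y - Y j‖ ^ 2 - g j)) + R := by
  obtain ⟨j, hj⟩ := exists_isFirstArgmin hn Y y g
  rw [hj.iInf_eq]
  refine (ciInf_le (Set.finite_range _).bddBelow j).trans ?_
  linarith [h j]

/-- A potential may be replaced by one with values in `[0, R]` if the costs are in `[0, R]`. -/
theorem exists_bounded_potential (hn : 0 < n) {lam : ℝ} (hl : 0 < lam) (Y : Fin n → E m) {R : ℝ}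
    (hR : 0 ≤ R) (g : Fin n → ℝ) :
    ∃ g' : Fin n → ℝ, (∀ j, 0 ≤ g' j ∧ g' j ≤ R) ∧
      ∀ x : E m, (∀ j, ‖x - Y j‖ ^ 2 ≤ R) → h1 lam Y x g ≤ h1 lam Y x g' := by
  have : Nonempty (Fin n) := ⟨⟨0, hn⟩⟩
  obtain ⟨a, ha⟩ := Finite.exists_max g
  -- Adding a constant to the potential does not change `h1`, so only the truncation from below at
  -- `g a - R` matters. It leaves the minimum intact: where it is active, the new gap is at least `R
  -- - g a`, which the gap at `a` does not exceed. Raising entries can only lower `logMean`.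
  refine ⟨fun j => max (g j) (g a - R) - (g a - R), fun j => ⟨?_, ?_⟩, fun x hx => ?_⟩
  · simp
  · have : max (g j) (g a - R) ≤ g a := max_le (ha j) (by linarith)
    linarith
  · have hle : logMean lam (fun j => max (g j) (g a - R) - (g a - R)) ≤
        logMean lam g + (g a - R) := by
      have := logMean_sub_le hn hl (fun j => max (g j) (g a - R) - (g a - R)) g
      refine (sub_le_iff_le_add'.1 this).trans ?_
      gcongr
      refine (Finset.sum_le_sum (g := fun j => Real.exp (-lam * (max (g j) (g a - R) - (g a - R))) /
          (∑ l, Real.exp (-lam * (max (g l) (g a - R) - (g a - R)))) * (g a - R)) fun j _ => ?_).trans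
        (le_of_eq ?_)
      · refine mul_le_mul_of_nonneg_left ?_ ?_
        · linarith [le_max_left (g j) (g a - R)]
        · exact div_nonneg (Real.exp_pos _).le (Finset.sum_nonneg fun _ _ => (Real.exp_pos _).le)
      · rw [← Finset.sum_mul, ← Finset.sum_div, div_self, one_mul]
        exact (sum_exp_pos hn lam _).ne'
    have h2 : ⨅ j, (‖x - Y j‖ ^ 2 - g j) ≤
        (⨅ j, (‖x - Y j‖ ^ 2 - (max (g j) (g a - R) - (g a - R)))) - (g a - R) := by
      rw [le_sub_iff_add_le]
      refine le_ciInf fun j => ?_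
      rcases le_total (g a - R) (g j) with h | h
      · rw [max_eq_left h]
        have := ciInf_le (f := fun j => ‖x - Y j‖ ^ 2 - g j) (Set.finite_range _).bddBelow j
        linarith
      · rw [max_eq_right h]
        have := ciInf_le (f := fun j => ‖x - Y j‖ ^ 2 - g j) (Set.finite_range _).bddBelow a
        have := hx a
        nlinarith [sq_nonneg ‖x - Y j‖]
    rw [h1_eq, h1_eq]
    linarith

end Deterministic

/-! ### The two inner loops: scan for the minimal gap, update of the potential. -/

namespace Prog

/-- Sequential composition of a list of programs. -/
def block : List Prog → Prog
  | [] => .skip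
  | p :: l => .seq p (block l)

/-- Real register 9 accumulates the squared distance of sample `nat 3` and data point `nat 4`. -/
def distLoop : Prog :=
  .loop 5 0 (block [.load 10 1 3 5, .load 11 0 4 5, .sub 10 10 11, .mul 10 10 10, .add 9 9 10])

/-- The precondition pins the initial memory to `τ`, so that the postcondition can compare with it.
The clauses excluding registers are the frame condition. -/
theorem distLoop_spec (τ : Store) (h9 : τ.real 9 = 0) :
    Spec (fun σ => σ = τ) distLoop (1 + τ.nat 0 * 7) (fun σ =>
      σ.arr = τ.arr ∧ (∀ q, q ≠ 5 → σ.nat q = τ.nat q) ∧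
      (∀ q, q ≠ 9 → q ≠ 10 → q ≠ 11 → σ.real q = τ.real q) ∧
      σ.real 9 = ∑ k ∈ Finset.range (τ.nat 0),
        (τ.arr 1 (τ.nat 3) k - τ.arr 0 (τ.nat 4) k) ^ 2) := by
  let I : ℕ → Store → Prop := fun K σ =>
      σ.arr = τ.arr ∧ (∀ q, q ≠ 5 → σ.nat q = τ.nat q) ∧
      (∀ q, q ≠ 9 → q ≠ 10 → q ≠ 11 → σ.real q = τ.real q) ∧
      σ.real 9 = ∑ k ∈ Finset.range K, (τ.arr 1 (τ.nat 3) k - τ.arr 0 (τ.nat 4) k) ^ 2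
  refine Spec.mono (Spec.loop (N := τ.nat 0) (T := 6) I ?_ ?_) ?_ (fun σ h => h) le_rfl
  · rintro σ ⟨-, h, -⟩
    exact h 0 (by decide)
  · rintro k - σ ⟨ρ, ⟨h1, h2, h3, h4⟩, rfl⟩
    refine ⟨⟨?_, ?_, ?_, ?_⟩, ?_⟩
    · simpa [block, exec, Store.setNat, Store.setReal] using h1
    · intro q hq
      simpa [block, exec, Store.setNat, Store.setReal, Function.update_apply, hq] using h2 q hq
    · intro q ha hb hc
      simpa [block, exec, Store.setNat, Store.setReal, Function.update_apply, ha, hb, hc]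
        using h3 q ha hb hc
    · rw [Finset.sum_range_succ, ← h4]
      simp [block, exec, Store.setNat, Store.setReal, h1, h2, sq]
    · simp [block, exec]
  · rintro σ rfl
    exact ⟨rfl, fun _ _ => rfl, fun _ _ _ _ => rfl, by simpa using h9⟩

/-- `‖x_i - Y_l‖² - g_l` in terms of the memory. -/
noncomputable def _root_.RSW.Store.gap (τ : Store) (l : ℕ) : ℝ :=
  ∑ k ∈ Finset.range (τ.nat 0), (τ.arr 1 (τ.nat 3) k - τ.arr 0 l k) ^ 2 - τ.arr 2 l 0

/-- `exp (-λ g_l)` in terms of the memory. -/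
noncomputable def _root_.RSW.Store.weight (τ : Store) (l : ℕ) : ℝ :=
  Real.exp (-τ.real 0 * τ.arr 2 l 0)

/-- The memory after `j` rounds of the scan for the minimal gap, started in memory `τ`. -/
structure ScanInv (τ : Store) (j : ℕ) (σ : Store) : Prop where
  arr : ∀ a, a ≠ 3 → σ.arr a = τ.arr a
  weights : ∀ l < j, σ.arr 3 l 0 = τ.weight l
  nat : ∀ q, q ≠ 4 → q ≠ 5 → q ≠ 6 → σ.nat q = τ.nat q
  real : ∀ q ∈ [0, 1, 2, 3, 4, 7, 8, 14], σ.real q = τ.real q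
  sum : σ.real 5 = ∑ l ∈ Finset.range j, τ.weight l
  best : 0 < j → σ.nat 6 < j ∧ σ.real 12 = τ.gap (σ.nat 6) ∧
    (∀ k < j, τ.gap (σ.nat 6) ≤ τ.gap k) ∧ ∀ k < σ.nat 6, τ.gap (σ.nat 6) < τ.gap k

/-- The memory in round `j` of the scan once the weight and the potential of `j` are known. -/
structure ScanMid (τ : Store) (j : ℕ) (σ : Store) : Prop where
  arr : ∀ a, a ≠ 3 → σ.arr a = τ.arr a
  weights : ∀ l < j + 1, σ.arr 3 l 0 = τ.weight l
  nat : ∀ q, q ≠ 4 → q ≠ 5 → q ≠ 6 → σ.nat q = τ.nat q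
  real : ∀ q ∈ [0, 1, 2, 3, 4, 7, 8, 14], σ.real q = τ.real q
  sum : σ.real 5 = ∑ l ∈ Finset.range (j + 1), τ.weight l
  best : 0 < j → σ.nat 6 < j ∧ σ.real 12 = τ.gap (σ.nat 6) ∧
    (∀ k < j, τ.gap (σ.nat 6) ≤ τ.gap k) ∧ ∀ k < σ.nat 6, τ.gap (σ.nat 6) < τ.gap k
  index : σ.nat 4 = j
  potential : σ.real 6 = τ.arr 2 j 0

/-- Integer register 7 and real register 7 hold 0. The former addresses column 0; the latter serves
to negate `λ` and to reset the distance accumulator. The weights go to array 3 because the update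
needs them once their sum is known. -/
def scanHead : Prog :=
  block [.load 6 2 4 7, .sub 10 7 0, .mul 10 10 6, .exp 13 10, .add 5 5 13, .store 3 4 7 13,
    .copy 9 7]

/-- The test `0 < j` singles out round 0, when register 12 does not yet hold a gap and must be set
unconditionally. Later rounds replace the record only on strict improvement, which keeps the lowest
minimizing index. -/
def scanTail : Prog :=
  block [.sub 9 9 6,
    .ifNatLt 7 4 (.ifLt 9 12 (.seq (.copy 12 9) (.natCopy 6 4)) .skip)
      (.seq (.copy 12 9) (.natCopy 6 4))]

def scanBody : Prog := .seq scanHead (.seq distLoop scanTail)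

theorem scanHead_spec (τ : Store) (h7 : τ.real 7 = 0) (hz : τ.nat 7 = 0) (j : ℕ) :
    Spec (fun σ => ∃ ρ, ScanInv τ j ρ ∧ σ = ρ.setNat 4 j) scanHead 8
      (fun σ => ScanMid τ j σ ∧ σ.real 9 = 0) := by
  rintro σ ⟨ρ, h, rfl⟩
  have r7 : ρ.real 7 = 0 := (h.real 7 (by simp)).trans h7
  have r0 : ρ.real 0 = τ.real 0 := h.real 0 (by simp)
  have n7 : ρ.nat 7 = 0 := (h.nat 7 (by decide) (by decide) (by decide)).trans hz
  have a2 : ρ.arr 2 = τ.arr 2 := h.arr 2 (by decide)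
  refine ⟨⟨⟨?_, ?_, ?_, ?_, ?_, ?_, ?_, ?_⟩, ?_⟩, ?_⟩
  · intro a ha
    rw [← h.arr a ha]
    ext i k
    simp [scanHead, block, exec, Store.setNat, Store.setReal, Store.setArr, ha]
  · intro l hl
    rcases Nat.lt_succ_iff_lt_or_eq.1 hl with hl | rfl
    · rw [← h.weights l hl]
      simp [scanHead, block, exec, Store.setNat, Store.setReal, Store.setArr, hl.ne]
    · simp [scanHead, block, exec, Store.setNat, Store.setReal, Store.setArr, r7, r0, n7, a2,
        Store.weight]
  · intro q ha hb hc
    rw [← h.nat q ha hb hc]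
    simp [scanHead, block, exec, Store.setNat, Store.setReal, Store.setArr, ha]
  · intro q hq
    rw [← h.real q hq]
    simp only [List.mem_cons, List.not_mem_nil, or_false] at hq
    rcases hq with rfl | rfl | rfl | rfl | rfl | rfl | rfl | rfl <;>
      simp [scanHead, block, exec, Store.setNat, Store.setReal, Store.setArr]
  · rw [Finset.sum_range_succ, ← h.sum]
    simp [scanHead, block, exec, Store.setNat, Store.setReal, Store.setArr, r7, r0, n7, a2,
      Store.weight]
  · simpa [scanHead, block, exec, Store.setNat, Store.setReal, Store.setArr] using h.best
  · simp [scanHead, block, exec, Store.setNat, Store.setReal, Store.setArr]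
  · simp [scanHead, block, exec, Store.setNat, Store.setReal, Store.setArr, n7, a2]
  · simp [scanHead, block, exec, Store.setNat, Store.setReal, Store.setArr, r7]
  · simp [scanHead, block, exec]

theorem scanDist_spec (τ : Store) (j : ℕ) :
    Spec (fun σ => ScanMid τ j σ ∧ σ.real 9 = 0) distLoop (1 + τ.nat 0 * 7)
      (fun σ => ScanMid τ j σ ∧ σ.real 9 - σ.real 6 = τ.gap j) := by
  rintro σ ⟨h, h9⟩
  have n0 : σ.nat 0 = τ.nat 0 := h.nat 0 (by decide) (by decide) (by decide)
  obtain ⟨⟨h1, h2, h3, h4⟩, h5⟩ := distLoop_spec σ h9 σ rfl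
  have r6 := h3 6 (by decide) (by decide) (by decide)
  refine ⟨⟨⟨?_, ?_, ?_, ?_, ?_, ?_, ?_, ?_⟩, ?_⟩, ?_⟩
  · rw [h1]; exact h.arr
  · rw [h1]; exact h.weights
  · intro q ha hb hc
    rw [h2 q hb, h.nat q ha hb hc]
  · intro q hq
    rw [← h.real q hq]
    apply h3 <;> rintro rfl <;> simp at hq
  · rw [h3 5 (by decide) (by decide) (by decide), h.sum]
  · rw [h2 6 (by decide), h3 12 (by decide) (by decide) (by decide)]
    exact h.best
  · rw [h2 4 (by decide), h.index]
  · rw [r6, h.potential]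
  · rw [h4, r6, h.potential, h.index, n0,
      h.nat 3 (by decide) (by decide) (by decide), h.arr 1 (by decide), h.arr 0 (by decide)]
    rfl
  · rw [← n0]; exact h5

theorem ScanMid.keep {τ σ : Store} {j : ℕ} (h : ScanMid τ j σ) (v : ℝ) (hj : 0 < j)
    (hv : τ.gap (σ.nat 6) ≤ τ.gap j) : ScanInv τ (j + 1) (σ.setReal 9 v) := by
  obtain ⟨b1, b2, b3, b4⟩ := h.best hj
  have hreal : ∀ q ∈ [0, 1, 2, 3, 4, 7, 8, 14], q ≠ 9 := by decide
  refine ⟨h.arr, h.weights, h.nat, fun q hq => ?_, ?_, fun _ => ⟨?_, ?_, fun k hk => ?_, b4⟩⟩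
  · simpa [Store.setReal, Function.update_apply, hreal q hq] using h.real q hq
  · simpa [Store.setReal] using h.sum
  · exact Nat.lt_succ_of_lt b1
  · simpa [Store.setReal] using b2
  · rcases Nat.lt_succ_iff_lt_or_eq.1 hk with hk | rfl
    · exact b3 k hk
    · exact hv

/-- A strict improvement on all earlier gaps is exactly what makes `j` the lowest minimizer so far.
For `j = 0` the condition is vacuous, which covers the initialization. -/
theorem ScanMid.replace {τ σ : Store} {j : ℕ} (h : ScanMid τ j σ)
    (hv : ∀ k < j, τ.gap j < τ.gap k) :
    ScanInv τ (j + 1) (((σ.setReal 9 (τ.gap j)).setReal 12 (τ.gap j)).setNat 6 j) := by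
  have hreal : ∀ q ∈ [0, 1, 2, 3, 4, 7, 8, 14], q ≠ 9 ∧ q ≠ 12 := by decide
  refine ⟨h.arr, h.weights, fun q ha hb hc => ?_, fun q hq => ?_, ?_, fun _ => ?_⟩
  · simpa [Store.setReal, Store.setNat, Function.update_apply, hc] using h.nat q ha hb hc
  · simpa [Store.setReal, Store.setNat, Function.update_apply, hreal q hq] using h.real q hq
  · simpa [Store.setReal, Store.setNat] using h.sum
  · simp only [Store.setReal, Store.setNat, Function.update_self]
    refine ⟨Nat.lt_succ_self j, trivial, fun k hk => ?_, hv⟩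
    rcases Nat.lt_succ_iff_lt_or_eq.1 hk with hk | rfl
    · exact (hv k hk).le
    · exact le_rfl

theorem scanTail_spec (τ : Store) (hz : τ.nat 7 = 0) (j : ℕ) :
    Spec (fun σ => ScanMid τ j σ ∧ σ.real 9 - σ.real 6 = τ.gap j) scanTail 6
      (ScanInv τ (j + 1)) := by
  rintro σ ⟨h, h9⟩
  have n7 : σ.nat 7 = 0 := (h.nat 7 (by decide) (by decide) (by decide)).trans hz
  have n4 := h.index
  rcases Nat.eq_zero_or_pos j with rfl | hj
  · have e : scanTail.exec σ =
        (((σ.setReal 9 (τ.gap 0)).setReal 12 (τ.gap 0)).setNat 6 0, 5) := by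
      simp [scanTail, block, exec, Store.setReal, Store.setNat, n7, n4, h9]
    rw [e]
    exact ⟨h.replace (by simp), by simp⟩
  · obtain ⟨b1, b2, b3, b4⟩ := h.best hj
    by_cases hlt : τ.gap j < σ.real 12
    · have e : scanTail.exec σ =
          (((σ.setReal 9 (τ.gap j)).setReal 12 (τ.gap j)).setNat 6 j, 6) := by
        simp [scanTail, block, exec, Store.setReal, Store.setNat, n7, n4, h9, hj, hlt]
      rw [e]
      exact ⟨h.replace fun k hk => (b2 ▸ hlt).trans_le (b3 k hk), le_rfl⟩
    · have e : scanTail.exec σ = (σ.setReal 9 (τ.gap j), 5) := by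
        simp [scanTail, block, exec, Store.setReal, n7, n4, h9, hj, hlt]
      rw [e]
      exact ⟨h.keep _ hj (b2 ▸ not_lt.1 hlt), by simp⟩

theorem scanBody_spec (τ : Store) (h7 : τ.real 7 = 0) (hz : τ.nat 7 = 0) (j : ℕ) :
    Spec (fun σ => ∃ ρ, ScanInv τ j ρ ∧ σ = ρ.setNat 4 j) scanBody
      (8 + (1 + τ.nat 0 * 7 + 6)) (ScanInv τ (j + 1)) :=
  (scanHead_spec τ h7 hz j).seq ((scanDist_spec τ j).seq (scanTail_spec τ hz j))

/-- The scan leaves the minimal gap in real register 12, the lowest index attaining it in integer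
register 6, and the sum of the weights in real register 5. -/
theorem scan_spec (τ : Store) (h7 : τ.real 7 = 0) (hz : τ.nat 7 = 0) (h5 : τ.real 5 = 0) :
    Spec (fun σ => σ = τ) (.loop 4 1 scanBody)
      (1 + τ.nat 1 * (8 + (1 + τ.nat 0 * 7 + 6) + 1)) (ScanInv τ (τ.nat 1)) := by
  refine Spec.mono (Spec.loop (N := τ.nat 1) (ScanInv τ)
    (fun σ h => h.nat 1 (by decide) (by decide) (by decide))
    (fun k _ => scanBody_spec τ h7 hz k)) ?_ (fun σ h => h) le_rfl
  rintro σ rfl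
  exact ⟨fun _ _ => rfl, by simp, fun _ _ _ _ => rfl, fun _ _ => rfl, by simpa using h5, by simp⟩

/-- The language has no equality test: the indicator of the minimizing index is reached when neither
strict comparison holds. Real register 14 holds 1. -/
def updateBody : Prog :=
  block [.load 10 3 4 7, .div 10 10 5,
    .ifNatLt 4 6 .skip (.ifNatLt 6 4 .skip (.sub 10 10 14)),
    .mul 10 4 10, .load 11 2 4 7, .add 11 11 10, .store 2 4 7 11]

/-- The memory after `j` rounds of the update of the potential, started in memory `τ`. -/
structure UpdateInv (τ : Store) (j : ℕ) (σ : Store) : Prop where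
  arr : ∀ a, a ≠ 2 → σ.arr a = τ.arr a
  old : ∀ l, j ≤ l → σ.arr 2 l 0 = τ.arr 2 l 0
  new : ∀ l < j, σ.arr 2 l 0 = τ.arr 2 l 0 +
    τ.real 4 * (τ.arr 3 l 0 / τ.real 5 - if l = τ.nat 6 then 1 else 0)
  nat : ∀ q, q ≠ 4 → σ.nat q = τ.nat q
  real : ∀ q, q ≠ 10 → q ≠ 11 → σ.real q = τ.real q

theorem updateBody_spec (τ : Store) (hz : τ.nat 7 = 0) (h14 : τ.real 14 = 1) (j : ℕ) :
    Spec (fun σ => ∃ ρ, UpdateInv τ j ρ ∧ σ = ρ.setNat 4 j) updateBody 10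
      (UpdateInv τ (j + 1)) := by
  rintro σ ⟨ρ, h, rfl⟩
  have n7 : ρ.nat 7 = 0 := (h.nat 7 (by decide)).trans hz
  have n6 : ρ.nat 6 = τ.nat 6 := h.nat 6 (by decide)
  have r4 := h.real 4 (by decide) (by decide)
  have r5 := h.real 5 (by decide) (by decide)
  have r14 : ρ.real 14 = 1 := (h.real 14 (by decide) (by decide)).trans h14
  have a3 := h.arr 3 (by decide)
  have aj := h.old j le_rfl
  set w := τ.arr 2 j 0 + τ.real 4 * (τ.arr 3 j 0 / τ.real 5 - if j = τ.nat 6 then 1 else 0)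
    with hw
  -- The three branches differ in step count and in the contents of scratch register 10, but agree
  -- on the cell written. Hiding the differences behind existentials lets the frame conditions be
  -- checked once.
  obtain ⟨u, v, c, hc, e⟩ : ∃ u v c, c ≤ 10 ∧ updateBody.exec (ρ.setNat 4 j) =
      ((((ρ.setNat 4 j).setReal 10 u).setReal 11 v).setArr 2 j 0 w, c) := by
    rcases lt_trichotomy j (τ.nat 6) with hlt | heq | hlt
    · refine ⟨τ.real 4 * (τ.arr 3 j 0 / τ.real 5), w, 9, by decide, ?_⟩
      simp [updateBody, block, exec, Store.setNat, Store.setReal, n7, n6, r4, r5, a3, aj, hlt,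
        hlt.ne, hw]
    · refine ⟨τ.real 4 * (τ.arr 3 j 0 / τ.real 5 - 1), w, 10, by decide, ?_⟩
      simp [updateBody, block, exec, Store.setNat, Store.setReal, n7, n6, r4, r5, a3, aj, r14,
        hw, heq.symm]
    · refine ⟨τ.real 4 * (τ.arr 3 j 0 / τ.real 5), w, 10, by decide, ?_⟩
      simp [updateBody, block, exec, Store.setNat, Store.setReal, n7, n6, r4, r5, a3, aj, hlt,
        hlt.ne', hlt.not_gt, hw]
  rw [e]
  refine ⟨⟨fun a ha => ?_, fun l hl => ?_, fun l hl => ?_, fun q hq => ?_, fun q ha hb => ?_⟩, hc⟩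
  · rw [← h.arr a ha]
    ext i k
    simp [Store.setArr, Store.setReal, Store.setNat, ha]
  · rw [← h.old l (by omega)]
    have : l ≠ j := by omega
    simp [Store.setArr, Store.setReal, Store.setNat, this]
  · rcases Nat.lt_succ_iff_lt_or_eq.1 hl with hl | rfl
    · rw [← h.new l hl]
      simp [Store.setArr, Store.setReal, Store.setNat, hl.ne]
    · simp [Store.setArr, hw]
  · simpa [Store.setArr, Store.setReal, Store.setNat, Function.update_apply, hq] using h.nat q hq
  · simpa [Store.setArr, Store.setReal, Store.setNat, Function.update_apply, ha, hb]
      using h.real q ha hb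

theorem update_spec (τ : Store) (hz : τ.nat 7 = 0) (h14 : τ.real 14 = 1) :
    Spec (fun σ => σ = τ) (.loop 4 1 updateBody) (1 + τ.nat 1 * (10 + 1))
      (UpdateInv τ (τ.nat 1)) := by
  refine Spec.mono (Spec.loop (N := τ.nat 1) (UpdateInv τ) (fun σ h => h.nat 1 (by decide))
    (fun k _ => updateBody_spec τ hz h14 k)) ?_ (fun σ h => h) le_rfl
  rintro σ rfl
  exact ⟨fun _ _ => rfl, fun _ _ => rfl, by simp, fun _ _ => rfl, fun _ _ _ => rfl⟩

end Prog
end RSW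

namespace RSW

namespace Prog

/-! ### The whole program, its correctness and its running time. -/

section Main

variable {m n : ℕ}

/-- The part of the memory that iteration `i` reads and leaves in place: constants, data and
samples. -/
structure Fixed (s : ℕ) (lam B : ℝ) (Y : Fin n → E m) (x : ℕ → E m) (σ : Store) : Prop where
  nat_m : σ.nat 0 = m
  nat_n : σ.nat 1 = n
  nat_s : σ.nat 2 = s
  nat_zero : σ.nat 7 = 0
  real_lam : σ.real 0 = lam
  real_B : σ.real 1 = B
  real_zero : σ.real 7 = 0
  real_n : σ.real 8 = n
  real_one : σ.real 14 = 1
  data : ∀ (j : Fin n) (k : Fin m), σ.arr 0 j k = Y j k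
  samples : ∀ i < s, ∀ k : Fin m, σ.arr 1 i k = x i k

/-- The sum of the weighted values of `h1` before iteration `i`. -/
noncomputable def valueSum (lam B : ℝ) (Y : Fin n → E m) (x : ℕ → E m) (i : ℕ) : ℝ :=
  ∑ k ∈ Finset.range i, rate n B (k + 1) * h1 lam Y (x k) (sgaIterate lam B Y 0 x k)

/-- The memory before iteration `i`. -/
structure MainInv (s : ℕ) (lam B : ℝ) (Y : Fin n → E m) (x : ℕ → E m) (i : ℕ) (σ : Store) :
    Prop extends Fixed s lam B Y x σ where
  value : σ.real 2 = valueSum lam B Y x i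
  rates : σ.real 3 = ∑ k ∈ Finset.range i, rate n B (k + 1)
  potential : ∀ j : Fin n, σ.arr 2 j 0 = sgaIterate lam B Y 0 x i j

def iterHead : Prog :=
  block [.natSucc 8 3, .ofNat 4 8, .div 4 8 4, .sqrt 4 4, .mul 4 1 4, .copy 5 7]

def iterMid : Prog :=
  block [.div 10 5 8, .log 10 10, .div 10 10 0, .sub 12 12 10, .mul 12 4 12, .add 2 2 12,
    .add 3 3 4]

def iterBody : Prog :=
  .seq iterHead (.seq (.loop 4 1 scanBody) (.seq iterMid (.loop 4 1 updateBody)))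

/-- The memory of iteration `i` when the scan starts. -/
structure IterStart (s : ℕ) (lam B : ℝ) (Y : Fin n → E m) (x : ℕ → E m) (i : ℕ) (σ : Store) :
    Prop extends MainInv s lam B Y x i σ where
  index : σ.nat 3 = i
  step : σ.real 4 = rate n B (i + 1)
  weightSum : σ.real 5 = 0

/-- The memory of iteration `i` when the update of the potential starts. -/
structure IterMiddle (s : ℕ) (lam B : ℝ) (Y : Fin n → E m) (x : ℕ → E m) (i : ℕ) (σ : Store) :
    Prop extends Fixed s lam B Y x σ where
  value : σ.real 2 = valueSum lam B Y x (i + 1)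
  rates : σ.real 3 = ∑ k ∈ Finset.range (i + 1), rate n B (k + 1)
  potential : ∀ j : Fin n, σ.arr 2 j 0 = sgaIterate lam B Y 0 x i j
  step : σ.real 4 = rate n B (i + 1)
  weights : ∀ j : Fin n, σ.arr 3 j 0 = Real.exp (-lam * sgaIterate lam B Y 0 x i j)
  weightSum : σ.real 5 = ∑ j, Real.exp (-lam * sgaIterate lam B Y 0 x i j)
  best : ∃ j : Fin n, IsFirstArgmin Y (x i) (sgaIterate lam B Y 0 x i) j ∧ σ.nat 6 = j

variable {s : ℕ} {lam B : ℝ} {Y : Fin n → E m} {x : ℕ → E m}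

theorem iterHead_spec (i : ℕ) :
    Spec (fun σ => ∃ ρ, MainInv s lam B Y x i ρ ∧ σ = ρ.setNat 3 i) iterHead 7
      (IterStart s lam B Y x i) := by
  rintro σ ⟨ρ, h, rfl⟩
  have e : iterHead.exec (ρ.setNat 3 i) =
      (⟨Function.update (Function.update ρ.nat 3 i) 8 (i + 1),
        Function.update (Function.update ρ.real 4 (rate n B (i + 1))) 5 0, ρ.arr⟩, 7) := by
    simp [iterHead, block, exec, Store.setNat, Store.setReal, h.real_zero, h.real_n, h.real_B,
      rate]
  rw [e]
  refine ⟨⟨⟨⟨h.nat_m, h.nat_n, h.nat_s, h.nat_zero, h.real_lam, h.real_B, h.real_zero,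
    h.real_n, h.real_one, h.data, h.samples⟩, h.value, h.rates, h.potential⟩, ?_, ?_, ?_⟩, le_rfl⟩
  all_goals simp

/-- This and `IterStart.weight_eq` translate what the scan computes from raw memory into the
quantities of the algorithm. -/
theorem IterStart.gap_eq {τ : Store} {i : ℕ} (h : IterStart s lam B Y x i τ) (hi : i < s)
    (j : Fin n) : τ.gap j = ‖x i - Y j‖ ^ 2 - sgaIterate lam B Y 0 x i j := by
  rw [Store.gap, h.nat_m, h.index, h.potential, EuclideanSpace.norm_sq_eq, Finset.sum_range]
  congr 1
  refine Finset.sum_congr rfl fun k _ => ?_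
  rw [h.samples i hi, h.data]
  simp

theorem IterStart.weight_eq {τ : Store} {i : ℕ} (h : IterStart s lam B Y x i τ) (j : Fin n) :
    τ.weight j = Real.exp (-lam * sgaIterate lam B Y 0 x i j) := by
  rw [Store.weight, h.real_lam, h.potential]

theorem iterMid_spec (hn : 0 < n) {i : ℕ} (hi : i < s) {τ : Store}
    (h : IterStart s lam B Y x i τ) :
    Spec (ScanInv τ n) iterMid 8 (IterMiddle s lam B Y x i) := by
  intro σ hσ
  have n' := hσ.nat
  have r' := hσ.real
  obtain ⟨b1, b2, b3, b4⟩ := hσ.best hn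
  have hw : σ.real 5 = ∑ j, Real.exp (-lam * sgaIterate lam B Y 0 x i j) := by
    rw [hσ.sum, Finset.sum_range]
    exact Finset.sum_congr rfl fun j _ => h.weight_eq j
  have hbest : IsFirstArgmin Y (x i) (sgaIterate lam B Y 0 x i) ⟨σ.nat 6, b1⟩ := by
    constructor
    · intro k
      rw [← h.gap_eq hi, ← h.gap_eq hi]
      exact b3 k k.2
    · intro k hk
      rw [← h.gap_eq hi, ← h.gap_eq hi]
      exact b4 k hk
  have r0 : σ.real 0 = lam := (r' 0 (by simp)).trans h.real_lam
  have r2 := (r' 2 (by simp)).trans h.value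
  have r3 := (r' 3 (by simp)).trans h.rates
  have r4 := (r' 4 (by simp)).trans h.step
  have r8 := (r' 8 (by simp)).trans h.real_n
  have hh : h1 lam Y (x i) (sgaIterate lam B Y 0 x i) =
      σ.real 12 - Real.log (σ.real 5 / n) / lam := by
    rw [h1, hbest.iInf_eq, b2, hw, ← h.gap_eq hi, ← Finset.mul_sum]
    ring_nf
  have e : ∃ u v, iterMid.exec σ = (⟨σ.nat, Function.update (Function.update (Function.update
      (Function.update σ.real 10 u) 12 v) 2 (valueSum lam B Y x (i + 1))) 3
      (∑ k ∈ Finset.range (i + 1), rate n B (k + 1)), σ.arr⟩, 8) := by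
    refine ⟨Real.log (σ.real 5 / n) / lam,
      rate n B (i + 1) * h1 lam Y (x i) (sgaIterate lam B Y 0 x i), ?_⟩
    rw [valueSum, Finset.sum_range_succ, Finset.sum_range_succ, ← r3, hh]
    rw [valueSum] at r2
    rw [← r2]
    simp [iterMid, block, exec, Store.setReal, r8, r0, r4]
  obtain ⟨u, v, e⟩ := e
  rw [e]
  have hn' : ∀ q ∈ [0, 1, 2, 7], σ.nat q = τ.nat q := by
    intro q hq
    apply n' <;> rintro rfl <;> simp at hq
  refine ⟨⟨⟨(hn' 0 (by simp)).trans h.nat_m, (hn' 1 (by simp)).trans h.nat_n,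
    (hn' 2 (by simp)).trans h.nat_s, (hn' 7 (by simp)).trans h.nat_zero, r0,
    (r' 1 (by simp)).trans h.real_B, (r' 7 (by simp)).trans h.real_zero, r8,
    (r' 14 (by simp)).trans h.real_one, ?_, ?_⟩, rfl, rfl, ?_, r4, ?_, hw,
    ⟨_, hbest, rfl⟩⟩, le_rfl⟩
  · rw [hσ.arr 0 (by decide)]; exact h.data
  · rw [hσ.arr 1 (by decide)]; exact h.samples
  · rw [hσ.arr 2 (by decide)]; exact h.potential
  · intro j
    rw [← h.weight_eq]
    exact hσ.weights j j.2

theorem UpdateInv.mainInv {τ σ : Store} {i : ℕ} (h : IterMiddle s lam B Y x i τ)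
    (hσ : UpdateInv τ n σ) : MainInv s lam B Y x (i + 1) σ := by
  have n' := hσ.nat
  have r' := fun q ha hb => hσ.real q ha hb
  refine ⟨⟨(n' 0 (by decide)).trans h.nat_m, (n' 1 (by decide)).trans h.nat_n,
    (n' 2 (by decide)).trans h.nat_s, (n' 7 (by decide)).trans h.nat_zero,
    (r' 0 (by decide) (by decide)).trans h.real_lam, (r' 1 (by decide) (by decide)).trans h.real_B,
    (r' 7 (by decide) (by decide)).trans h.real_zero,
    (r' 8 (by decide) (by decide)).trans h.real_n,
    (r' 14 (by decide) (by decide)).trans h.real_one, ?_, ?_⟩,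
    (r' 2 (by decide) (by decide)).trans h.value,
    (r' 3 (by decide) (by decide)).trans h.rates, fun j => ?_⟩
  · rw [hσ.arr 0 (by decide)]; exact h.data
  · rw [hσ.arr 1 (by decide)]; exact h.samples
  · obtain ⟨b, hb, hb'⟩ := h.best
    rw [hσ.new j j.2, sgaIterate]
    beta_reduce
    rw [hb.ite_eq, h.potential, h.step, h.weights, h.weightSum, hb']
    simp only [Fin.ext_iff]

theorem iterBody_spec (hn : 0 < n) {i : ℕ} (hi : i < s) :
    Spec (fun σ => ∃ ρ, MainInv s lam B Y x i ρ ∧ σ = ρ.setNat 3 i) iterBody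
      (7 + ((1 + n * (8 + (1 + m * 7 + 6) + 1)) + (8 + (1 + n * (10 + 1)))))
      (MainInv s lam B Y x (i + 1)) := by
  refine (iterHead_spec i).seq fun τ h => ?_
  have hs := scan_spec τ h.real_zero h.nat_zero h.weightSum
  rw [h.nat_n, h.nat_m] at hs
  refine (hs.seq ((iterMid_spec hn hi h).seq fun ρ hρ => ?_)) τ rfl
  have hu := update_spec ρ hρ.nat_zero hρ.real_one ρ rfl
  rw [hρ.nat_n] at hu
  exact ⟨hu.1.mainInv hρ, hu.2⟩

def sgaHead : Prog :=
  block [.natLit 7 0, .ofNat 7 7, .ofNat 8 1, .copy 2 7, .copy 3 7, .natLit 8 1, .ofNat 14 8]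

/-- Stochastic subgradient ascent. -/
def sga : Prog :=
  .seq sgaHead (.seq (.loop 3 2 iterBody) (.div 0 2 3))

theorem sga_spec (hn : 0 < n) :
    Spec (fun σ => HoldsInput σ s lam B Y x 0) sga
      (8 + ((1 + s * (7 + ((1 + n * (8 + (1 + m * 7 + 6) + 1)) + (8 + (1 + n * (10 + 1)))) + 1))
        + 1)) (fun σ => HoldsOutput σ s lam B Y x 0) := by
  refine Spec.seq (J := MainInv s lam B Y x 0) ?_ (Spec.seq (J := MainInv s lam B Y x s) ?_ ?_)
  · intro σ h
    have e : sgaHead.exec σ = (⟨Function.update (Function.update σ.nat 7 0) 8 1,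
        Function.update (Function.update (Function.update (Function.update (Function.update
          σ.real 7 0) 8 n) 2 0) 3 0) 14 1, σ.arr⟩, 8) := by
      simp [sgaHead, block, exec, Store.setNat, Store.setReal, h.nat_n]
    rw [e]
    exact ⟨⟨⟨h.nat_m, h.nat_n, h.nat_s, rfl, h.real_lam, h.real_B, rfl, rfl, rfl, h.data,
      h.samples⟩, by simp [valueSum], by simp, h.init⟩, le_rfl⟩
  · exact Spec.loop (MainInv s lam B Y x) (fun σ h => h.nat_s) fun i hi => iterBody_spec hn hi
  · intro σ h
    refine ⟨⟨?_, h.potential⟩, le_rfl⟩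
    simp only [exec, Store.setReal, Function.update_self, h.value, h.rates, sgaEstimate, valueSum]
    ring

theorem sga_time :
    ∀ m : ℕ, ∃ C : ℝ, 0 < C ∧
      ∀ (n : ℕ) (Y : Fin n → RSW.E m) (x : ℕ → RSW.E m) (lam B ε : ℝ) (σ : RSW.Store),
        0 < n → 0 < ε → ε ^ 2 ≤ n →
        RSW.HoldsInput σ (RSW.numIter n ε) lam B Y x 0 →
        RSW.HoldsOutput (sga.exec σ).1 (RSW.numIter n ε) lam B Y x 0 ∧
        ((sga.exec σ).2 : ℝ) ≤ C * ((n : ℝ) ^ 2 / ε ^ 2) := by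
  intro m
  -- The total is `10 + 18 s + (27 + 7 m) s n` steps, which `s, n ≥ 1` bounds by `(7 m + 60) s n`.
  -- The factor 2 pays for rounding up: `n / ε² ≥ 1` gives `s ≤ 2 n / ε²`.
  refine ⟨2 * (7 * m + 60), by positivity, fun n Y x lam B ε σ hn hε hεn hσ => ?_⟩
  obtain ⟨h1, h2⟩ := sga_spec hn σ hσ
  refine ⟨h1, ?_⟩
  have hq : 1 ≤ (n : ℝ) / ε ^ 2 := (one_le_div (by positivity)).2 hεn
  have hs : ((numIter n ε : ℕ) : ℝ) ≤ 2 * (n / ε ^ 2) := by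
    have := (Nat.ceil_lt_add_one (zero_le_one.trans hq)).le
    rw [numIter]
    linarith
  have hs1 : 1 ≤ numIter n ε := Nat.one_le_ceil_iff.2 (by linarith)
  generalize numIter n ε = s at *
  have hb : (sga.exec σ).2 ≤ (7 * m + 60) * (s * n) := by
    refine h2.trans ?_
    have h3 : 1 ≤ s * n := Nat.mul_pos hs1 hn
    have h4 : s ≤ s * n := Nat.le_mul_of_pos_right s hn
    have e : 8 + ((1 + s * (7 + ((1 + n * (8 + (1 + m * 7 + 6) + 1)) + (8 + (1 + n * (10 + 1))))
        + 1)) + 1) = 10 + 18 * s + 27 * (s * n) + 7 * m * (s * n) := by ring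
    rw [e, Nat.add_mul]
    omega
  have hn' : (0 : ℝ) < n := by exact_mod_cast hn
  calc ((sga.exec σ).2 : ℝ) ≤ (7 * m + 60) * (s * n) := by exact_mod_cast hb
    _ ≤ (7 * m + 60) * (2 * (n / ε ^ 2) * n) := by gcongr
    _ = 2 * (7 * m + 60) * ((n : ℝ) ^ 2 / ε ^ 2) := by ring

end Main
end Prog
end RSW

namespace RSW

/-! ### Weak duality. -/

section Duality

variable {m n : ℕ}

theorem logMean_anti (hn : 0 < n) {lam : ℝ} (hl : 0 < lam) {g g' : Fin n → ℝ}
    (h : ∀ j, g j ≤ g' j) : logMean lam g' ≤ logMean lam g := by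
  have := logMean_sub_le hn hl g' g
  have h2 : ∑ j, Real.exp (-lam * g' j) / (∑ l, Real.exp (-lam * g' l)) * (g j - g' j) ≤ 0 := by
    refine Finset.sum_nonpos fun j _ => mul_nonpos_of_nonneg_of_nonpos ?_ (by linarith [h j])
    exact div_nonneg (Real.exp_pos _).le (sum_exp_pos hn lam g').le
  linarith

theorem measurable_iInf_cost (Y : Fin n → E m) (g : Fin n → ℝ) :
    Measurable fun x : E m => ⨅ j, (‖x - Y j‖ ^ 2 - g j) :=
  Measurable.iInf fun j => by fun_prop

theorem abs_iInf_cost_le (hn : 0 < n) {Y : Fin n → E m} {x : E m} {R K : ℝ} {g : Fin n → ℝ}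
    (hR : ∀ j, ‖x - Y j‖ ^ 2 ≤ R) (hg : ∀ j, |g j| ≤ K) :
    |⨅ j, (‖x - Y j‖ ^ 2 - g j)| ≤ R + K := by
  obtain ⟨j, hj⟩ := exists_isFirstArgmin hn Y x g
  rw [hj.iInf_eq, abs_le]
  have := abs_le.1 (hg j)
  have := hR j
  constructor <;> nlinarith [sq_nonneg ‖x - Y j‖]

theorem integrable_iInf_cost (hn : 0 < n) {Y : Fin n → E m} {P : Measure (E m)}
    [IsFiniteMeasure P] {R : ℝ} (hR : ∀ᵐ x ∂P, ∀ j, ‖x - Y j‖ ^ 2 ≤ R) (g : Fin n → ℝ) :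
    Integrable (fun x : E m => ⨅ j, (‖x - Y j‖ ^ 2 - g j)) P := by
  refine Integrable.of_bound (C := R + ∑ j, |g j|)
    (measurable_iInf_cost Y g).aestronglyMeasurable ?_
  filter_upwards [hR] with x hx
  exact abs_iInf_cost_le hn hx fun j =>
    Finset.single_le_sum (f := fun j => |g j|) (fun _ _ => abs_nonneg _) (Finset.mem_univ j)

/-- A potential on the data points, extended to a bounded measurable function that takes the
largest value among coinciding data points. -/
theorem exists_extended_potential (Y : Fin n → E m) (g : Fin n → ℝ) :
    ∃ f : E m → ℝ, Measurable f ∧ (∃ K, ∀ y, |f y| ≤ K) ∧ (∀ j, g j ≤ f (Y j)) ∧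
      ∀ j, ∃ k, Y k = Y j ∧ f (Y j) = g k := by
  classical
  rcases isEmpty_or_nonempty (Fin n) with h | h
  · exact ⟨0, measurable_const, ⟨0, by simp⟩, fun j => h.elim j, fun j => h.elim j⟩
  set K := ∑ j, |g j| with hK
  have hgK : ∀ j, |g j| ≤ K := fun j =>
    Finset.single_le_sum (f := fun j => |g j|) (fun _ _ => abs_nonneg _) (Finset.mem_univ j)
  have hbd : ∀ y, BddAbove (Set.range fun j => if y = Y j then g j else -K) := fun y =>
    (Set.finite_range _).bddAbove
  have hle : ∀ j, g j ≤ ⨆ k, (if Y j = Y k then g k else -K) := fun j => by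
    simpa using le_ciSup (hbd (Y j)) j
  -- The default `-K` lies below every `g j`, so at a data point it does not affect the supremum;
  -- away from the data the function is constantly `-K`.
  refine ⟨fun y => ⨆ j, (if y = Y j then g j else -K), ?_, ⟨K, fun y => ?_⟩, hle, fun j => ?_⟩
  · refine Measurable.iSup fun j => Measurable.ite ?_ measurable_const measurable_const
    exact measurableSet_eq
  · obtain ⟨k, hk⟩ := exists_eq_ciSup_of_finite (f := fun j => if y = Y j then g j else -K)
    have hK0 : 0 ≤ K := Finset.sum_nonneg fun _ _ => abs_nonneg _
    beta_reduce at hk ⊢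
    rw [← hk]
    split_ifs
    · exact hgK k
    · rw [abs_neg, abs_of_nonneg hK0]
  · obtain ⟨k, hk⟩ := exists_eq_ciSup_of_finite (f := fun k => if Y j = Y k then g k else -K)
    have hj := hle j
    beta_reduce
    rw [← hk] at hj ⊢
    by_cases h1 : Y j = Y k
    · exact ⟨k, h1.symm, by simp [h1]⟩
    · refine ⟨j, rfl, le_antisymm ?_ hj⟩
      simpa [h1] using (abs_le.1 (hgK j)).1

theorem isProbabilityMeasure_empirical (hn : 0 < n) (Y : Fin n → E m) :
    IsProbabilityMeasure (empirical Y) := by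
  refine ⟨?_⟩
  simp only [empirical, Measure.coe_finsetSum, Finset.sum_apply, Measure.smul_apply,
    measure_univ, smul_eq_mul, mul_one, Finset.sum_const, Finset.card_univ, Fintype.card_fin,
    nsmul_eq_mul]
  exact ENNReal.mul_inv_cancel (by simp [hn.ne']) (by simp)

theorem integral_empirical (hn : 0 < n) (Y : Fin n → E m) (f : E m → ℝ) :
    ∫ y, f y ∂(empirical Y) = ∑ j, (1 / (n : ℝ)) * f (Y j) := by
  rw [empirical, integral_finsetSum_measure]
  · refine Finset.sum_congr rfl fun j _ => ?_
    rw [integral_smul_measure, integral_dirac]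
    simp
  · intro j _
    refine Integrable.smul_measure ?_ (by simp [hn.ne'])
    exact (integrable_dirac (by simp))

theorem ae_empirical (Y : Fin n → E m) : ∀ᵐ y ∂(empirical Y), ∃ j, Y j = y := by
  have hms : MeasurableSet {y : E m | ∃ j, Y j = y} := (Set.finite_range Y).measurableSet
  rw [ae_iff, empirical]
  simp only [Measure.coe_finsetSum, Finset.sum_apply, Measure.smul_apply]
  refine Finset.sum_eq_zero fun j _ => ?_
  rw [Measure.dirac_apply' _ (by exact hms.compl)]
  simp

/-- The Donsker–Varadhan inequality for bounded functions. -/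
theorem integral_sub_log_le_klDiv {α : Type*} [MeasurableSpace α] {μ ν : Measure α}
    [IsProbabilityMeasure μ] [IsProbabilityMeasure ν] (h : InformationTheory.klDiv μ ν ≠ ∞)
    {f : α → ℝ} (hf : Measurable f) {K : ℝ} (hK : ∀ x, |f x| ≤ K) :
    ∫ x, f x ∂μ - Real.log (∫ x, Real.exp (f x) ∂ν) ≤ (InformationTheory.klDiv μ ν).toReal := by
  obtain ⟨hac, hint⟩ := InformationTheory.klDiv_ne_top_iff.1 h
  have hfμ : Integrable f μ := Integrable.of_bound (C := K) hf.aestronglyMeasurable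
    (Filter.Eventually.of_forall hK)
  have hfν : Integrable (fun x => Real.exp (f x)) ν := by
    refine Integrable.of_bound (C := Real.exp K) hf.exp.aestronglyMeasurable
      (Filter.Eventually.of_forall fun x => ?_)
    rw [Real.norm_eq_abs, Real.abs_exp]
    exact Real.exp_le_exp.2 ((le_abs_self _).trans (hK x))
  have : IsProbabilityMeasure (ν.tilted f) := isProbabilityMeasure_tilted hfν
  -- The inequality is the nonnegativity of the divergence of `μ` from `ν.tilted f`, whose
  -- log-likelihood ratio is that of `μ` and `ν` minus `f` plus the log-normalizer.
  have h1 := InformationTheory.integral_llr_add_sub_measure_univ_nonneg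
    (hac.trans (absolutelyContinuous_tilted hfν))
    (integrable_llr_tilted_right hac hfμ hint hfν)
  rw [integral_llr_tilted_right hac hfμ hfν hint] at h1
  rw [InformationTheory.toReal_klDiv hac hint]
  simp only [probReal_univ] at h1 ⊢
  linarith

theorem W2_sq (P Q : Measure (E m)) :
    W2 P Q ^ 2 = ⨅ π ∈ couplings P Q, ∫⁻ p, ‖p.1 - p.2‖ₑ ^ 2 ∂π := by
  rw [W2, ← ENNReal.rpow_natCast, ← ENNReal.rpow_mul]
  norm_num

/-- Weak duality. -/
theorem integral_h1_le_ell (hn : 0 < n) {lam : ℝ} (hl : 0 < lam) {Y : Fin n → E m}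
    {P : Measure (E m)} [IsProbabilityMeasure P] {R : ℝ}
    (hR : ∀ᵐ x ∂P, ∀ j, ‖x - Y j‖ ^ 2 ≤ R) (g : Fin n → ℝ) :
    ENNReal.ofReal (∫ x, h1 lam Y x g ∂P) ≤ ell lam (empirical Y) P := by
  have := isProbabilityMeasure_empirical hn Y
  refine le_iInf fun Q => le_iInf fun hQ => le_iInf fun hac => ?_
  by_cases hkl : InformationTheory.klDiv Q (empirical Y) = ∞
  · rw [hkl, ENNReal.mul_top (by simpa using hl)]
    simp
  -- The entropy term is moved across so that the infimum over couplings stands alone and one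
  -- coupling can be fixed.
  rw [W2_sq, ← tsub_le_iff_left]
  refine le_iInf₂ fun π hπ => ?_
  rw [tsub_le_iff_left]
  by_cases hc : ∫⁻ p, ‖p.1 - p.2‖ₑ ^ 2 ∂π = ∞
  · rw [hc]; simp
  obtain ⟨f, hf, ⟨K, hK⟩, hgf, hfg⟩ := exists_extended_potential Y g
  have hπP : IsProbabilityMeasure π := by
    refine ⟨?_⟩
    have : (π.map Prod.fst) Set.univ = 1 := by rw [hπ.1]; exact measure_univ
    rwa [Measure.map_apply measurable_fst MeasurableSet.univ, Set.preimage_univ] at this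
  have hm2 : Measurable fun p : E m × E m => ‖p.1 - p.2‖ ^ 2 := by fun_prop
  have he : ∀ p : E m × E m, ‖p.1 - p.2‖ₑ ^ 2 = ENNReal.ofReal (‖p.1 - p.2‖ ^ 2) := fun p => by
    rw [ENNReal.ofReal_pow (norm_nonneg _), ofReal_norm]
  simp only [he] at hc ⊢
  have hcint : Integrable (fun p : E m × E m => ‖p.1 - p.2‖ ^ 2) π := by
    refine ⟨hm2.aestronglyMeasurable, ?_⟩
    rw [hasFiniteIntegral_iff_ofReal (Filter.Eventually.of_forall fun _ => sq_nonneg _)]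
    exact lt_top_iff_ne_top.2 hc
  rw [← ofReal_integral_eq_lintegral_ofReal hcint
    (Filter.Eventually.of_forall fun _ => sq_nonneg _), ← ENNReal.ofReal_toReal hkl,
    ← ENNReal.ofReal_mul (by positivity), ← ENNReal.ofReal_add (by positivity)
      (integral_nonneg fun _ => sq_nonneg _)]
  refine ENNReal.ofReal_le_ofReal ?_
  have hφ := integrable_iInf_cost hn hR g
  have hfQ : Integrable f Q := Integrable.of_bound (C := K) hf.aestronglyMeasurable
    (Filter.Eventually.of_forall hK)
  -- Since `Q` is absolutely continuous with respect to the empirical measure, the second coordinate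
  -- is almost surely a data point. There `f` equals some `g k` with `Y k` at that point, and the
  -- minimum is at most the gap of `k`.
  have hcost : (∫ x, ⨅ j, (‖x - Y j‖ ^ 2 - g j) ∂P) + ∫ y, f y ∂Q ≤
      ∫ p, ‖p.1 - p.2‖ ^ 2 ∂π := by
    have hφ' : Integrable (fun p : E m × E m => ⨅ j, (‖p.1 - Y j‖ ^ 2 - g j)) π := by
      have h' := hπ.1 ▸ hφ
      exact h'.comp_measurable measurable_fst
    have hf' : Integrable (fun p : E m × E m => f p.2) π := by
      have h' := hπ.2 ▸ hfQ
      exact h'.comp_measurable measurable_snd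
    have e1 : ∫ x, ⨅ j, (‖x - Y j‖ ^ 2 - g j) ∂P = ∫ p, ⨅ j, (‖p.1 - Y j‖ ^ 2 - g j) ∂π := by
      rw [← hπ.1, integral_map measurable_fst.aemeasurable
        (measurable_iInf_cost Y g).aestronglyMeasurable]
    have e2 : ∫ y, f y ∂Q = ∫ p, f p.2 ∂π := by
      rw [← hπ.2, integral_map measurable_snd.aemeasurable hf.aestronglyMeasurable]
    rw [e1, e2, ← integral_add hφ' hf']
    refine integral_mono_ae (hφ'.add hf') hcint ?_
    have hae : ∀ᵐ p ∂π, ∃ j, Y j = p.2 := by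
      have : ∀ᵐ y ∂(π.map Prod.snd), ∃ j, Y j = y := by
        rw [hπ.2]; exact hac.ae_le (ae_empirical Y)
      exact ae_of_ae_map measurable_snd.aemeasurable this
    filter_upwards [hae] with p ⟨j, hj⟩
    obtain ⟨k, hk, hfk⟩ := hfg j
    have := ciInf_le (f := fun j => ‖p.1 - Y j‖ ^ 2 - g j) (Set.finite_range _).bddBelow k
    rw [← hj, hfk]
    rw [hk] at this
    linarith
  -- Donsker–Varadhan with `-λ f` gives the bound with `f` in the logarithm; as `f` dominates `g` at
  -- the data points, `logMean` of `g` is only larger.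
  have h2 := integral_sub_log_le_klDiv hkl (f := fun y => -lam * f y) (hf.const_mul _)
    (K := lam * K) fun y => by
      rw [abs_mul, abs_neg, abs_of_pos hl]
      exact mul_le_mul_of_nonneg_left (hK y) hl.le
  rw [integral_empirical hn Y, integral_const_mul] at h2
  have h3 : logMean lam (fun j => f (Y j)) ≤ logMean lam g := logMean_anti hn hl hgf
  have h4 : ∫ x, h1 lam Y x g ∂P = (∫ x, ⨅ j, (‖x - Y j‖ ^ 2 - g j) ∂P) - logMean lam g := by
    simp only [h1_eq]
    rw [integral_sub hφ (integrable_const _)]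
    simp
  have h5 := mul_le_mul_of_nonneg_left h2 (by positivity : 0 ≤ 1 / lam)
  rw [mul_sub, ← logMean, ← mul_assoc, mul_neg, one_div_mul_cancel hl.ne'] at h5
  rw [h4]
  linarith

end Duality

/-! ### Entropic smoothing of the dual and its maximizer. -/

section Smoothing

variable {m n : ℕ}

/-- The normalization of the entropic smoothing of `min_j (‖x - Y_j‖² - g_j)`. -/
noncomputable def partitionSum (η : ℝ) (Y : Fin n → E m) (g : Fin n → ℝ) (x : E m) : ℝ :=
  ∑ j, Real.exp ((g j - ‖x - Y j‖ ^ 2) / η)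

/-- The entropic smoothing of `min_j (‖x - Y_j‖² - g_j)`. -/
noncomputable def softMin (η : ℝ) (Y : Fin n → E m) (g : Fin n → ℝ) (x : E m) : ℝ :=
  -η * Real.log (partitionSum η Y g x)

/-- The conditional probability of `Y_j` given `x` in the entropic transport plan. -/
noncomputable def softArgmin (η : ℝ) (Y : Fin n → E m) (g : Fin n → ℝ) (x : E m) (j : Fin n) : ℝ :=
  Real.exp ((g j - ‖x - Y j‖ ^ 2) / η) / partitionSum η Y g x

theorem partitionSum_pos (hn : 0 < n) (η : ℝ) (Y : Fin n → E m) (g : Fin n → ℝ) (x : E m) :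
    0 < partitionSum η Y g x := by
  have : Nonempty (Fin n) := ⟨⟨0, hn⟩⟩
  exact Finset.sum_pos (fun _ _ => Real.exp_pos _) Finset.univ_nonempty

theorem softArgmin_nonneg (hn : 0 < n) (η : ℝ) (Y : Fin n → E m) (g : Fin n → ℝ) (x : E m)
    (j : Fin n) : 0 ≤ softArgmin η Y g x j :=
  div_nonneg (Real.exp_pos _).le (partitionSum_pos hn η Y g x).le

theorem softArgmin_pos (hn : 0 < n) (η : ℝ) (Y : Fin n → E m) (g : Fin n → ℝ) (x : E m)
    (j : Fin n) : 0 < softArgmin η Y g x j :=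
  div_pos (Real.exp_pos _) (partitionSum_pos hn η Y g x)

theorem sum_softArgmin (hn : 0 < n) (η : ℝ) (Y : Fin n → E m) (g : Fin n → ℝ) (x : E m) :
    ∑ j, softArgmin η Y g x j = 1 := by
  simp only [softArgmin]
  rw [← Finset.sum_div]
  exact div_self (partitionSum_pos hn η Y g x).ne'

theorem softArgmin_le_one (hn : 0 < n) (η : ℝ) (Y : Fin n → E m) (g : Fin n → ℝ) (x : E m)
    (j : Fin n) : softArgmin η Y g x j ≤ 1 := by
  rw [← sum_softArgmin hn η Y g x]
  exact Finset.single_le_sum (fun k _ => softArgmin_nonneg hn η Y g x k) (Finset.mem_univ j)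

theorem measurable_partitionSum (η : ℝ) (Y : Fin n → E m) (g : Fin n → ℝ) :
    Measurable (partitionSum η Y g) := by
  unfold partitionSum; fun_prop

theorem measurable_softMin (η : ℝ) (Y : Fin n → E m) (g : Fin n → ℝ) :
    Measurable (softMin η Y g) :=
  (measurable_partitionSum η Y g).log.const_mul _

theorem measurable_softArgmin (η : ℝ) (Y : Fin n → E m) (g : Fin n → ℝ) (j : Fin n) :
    Measurable fun x => softArgmin η Y g x j :=
  Measurable.div (by fun_prop) (measurable_partitionSum η Y g)

theorem integrable_softArgmin (hn : 0 < n) (η : ℝ) (Y : Fin n → E m) (g : Fin n → ℝ) (j : Fin n)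
    (P : Measure (E m)) [IsFiniteMeasure P] : Integrable (fun x => softArgmin η Y g x j) P :=
  Integrable.of_bound (C := 1) (measurable_softArgmin η Y g j).aestronglyMeasurable
    (Filter.Eventually.of_forall fun x => by
      rw [Real.norm_eq_abs, abs_of_nonneg (softArgmin_nonneg hn η Y g x j)]
      exact softArgmin_le_one hn η Y g x j)

theorem softMin_le {η : ℝ} (hη : 0 < η) (Y : Fin n → E m) (g : Fin n → ℝ) (x : E m) (j : Fin n) :
    softMin η Y g x ≤ ‖x - Y j‖ ^ 2 - g j := by
  have h : Real.exp ((g j - ‖x - Y j‖ ^ 2) / η) ≤ partitionSum η Y g x :=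
    Finset.single_le_sum (f := fun j => Real.exp ((g j - ‖x - Y j‖ ^ 2) / η))
      (fun _ _ => (Real.exp_pos _).le) (Finset.mem_univ j)
  have h2 := (Real.le_log_iff_exp_le ((Real.exp_pos _).trans_le h)).2 h
  rw [div_le_iff₀ hη] at h2
  unfold softMin
  linarith

/-- `softMin` is 1-Lipschitz in the potential. -/
theorem softMin_le_add (hn : 0 < n) {η : ℝ} (hη : 0 < η) (Y : Fin n → E m) (g g' : Fin n → ℝ)
    (x : E m) : softMin η Y g x ≤ softMin η Y g' x + dist g g' := by
  have h : partitionSum η Y g' x ≤ Real.exp (dist g g' / η) * partitionSum η Y g x := by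
    unfold partitionSum
    rw [Finset.mul_sum]
    refine Finset.sum_le_sum fun j _ => ?_
    rw [← Real.exp_add, ← add_div]
    have := (abs_le.1 ((Real.dist_eq _ _).symm.le.trans (dist_le_pi_dist g g' j))).1
    gcongr
    linarith
  have h2 := Real.log_le_log (partitionSum_pos hn η Y g' x) h
  rw [Real.log_mul (Real.exp_pos _).ne' (partitionSum_pos hn η Y g x).ne', Real.log_exp] at h2
  have h3 := mul_le_mul_of_nonneg_left h2 hη.le
  rw [mul_add, mul_div_cancel₀ _ hη.ne'] at h3
  unfold softMin
  linarith

/-- The average cost under the entropic plan exceeds the minimum by at most `η log n`. -/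
theorem sum_softArgmin_mul_le (hn : 0 < n) {η : ℝ} (hη : 0 < η) (Y : Fin n → E m) (g : Fin n → ℝ)
    (x : E m) : ∑ j, softArgmin η Y g x j * (‖x - Y j‖ ^ 2 - g j) ≤
      softMin η Y g x + η * Real.log n := by
  have hn' : (0 : ℝ) < n := by exact_mod_cast hn
  have hj : ∀ j, softArgmin η Y g x j * (‖x - Y j‖ ^ 2 - g j) ≤
      softArgmin η Y g x j * (softMin η Y g x + η * Real.log n) +
        η * (1 / n - softArgmin η Y g x j) := by
    intro j
    have hp := softArgmin_pos hn η Y g x j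
    have hS := partitionSum_pos hn η Y g x
    set p := softArgmin η Y g x j with hpd
    have hlog : Real.log p = (g j - ‖x - Y j‖ ^ 2) / η - Real.log (partitionSum η Y g x) := by
      rw [hpd, softArgmin, Real.log_div (Real.exp_pos _).ne' hS.ne', Real.log_exp]
    have e : ‖x - Y j‖ ^ 2 - g j = -η * Real.log p + softMin η Y g x := by
      rw [hlog, softMin]
      field_simp
      ring
    -- This is the bound `log n` on the entropy of a distribution on `n` points, taken term by term;
    -- the corrections `1/n - p` sum to zero.
    have h1 : Real.log (1 / (n * p)) ≤ 1 / (n * p) - 1 :=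
      Real.log_le_sub_one_of_pos (by positivity)
    rw [one_div, Real.log_inv, Real.log_mul hn'.ne' hp.ne'] at h1
    have h2 := mul_le_mul_of_nonneg_left h1 (mul_pos hη hp).le
    have e2 : η * p * ((n * p)⁻¹ - 1) = η * (1 / n - p) := by field_simp
    rw [e2] at h2
    rw [e]
    linarith
  refine (Finset.sum_le_sum fun j _ => hj j).trans (le_of_eq ?_)
  rw [Finset.sum_add_distrib, ← Finset.sum_mul, sum_softArgmin hn, ← Finset.mul_sum,
    Finset.sum_sub_distrib, sum_softArgmin hn]
  simp only [Finset.sum_const, Finset.card_univ, Fintype.card_fin, nsmul_eq_mul]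
  field_simp
  ring

theorem hasDerivAt_softMin (hn : 0 < n) {η : ℝ} (hη : 0 < η) (Y : Fin n → E m) (g : Fin n → ℝ)
    (x : E m) (j : Fin n) (t : ℝ) :
    HasDerivAt (fun t : ℝ => softMin η Y (g + t • Pi.single j 1) x)
      (-softArgmin η Y (g + t • Pi.single j 1) x j) t := by
  have h1 : ∀ l, HasDerivAt (fun t : ℝ => Real.exp (((g + t • (Pi.single j 1 : Fin n → ℝ)) l
        - ‖x - Y l‖ ^ 2) / η))
      (Real.exp (((g + t • (Pi.single j 1 : Fin n → ℝ)) l - ‖x - Y l‖ ^ 2) / η) *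
        ((Pi.single j 1 : Fin n → ℝ) l / η)) t := by
    intro l
    have h0 : HasDerivAt (fun t : ℝ => ((g + t • (Pi.single j 1 : Fin n → ℝ)) l
        - ‖x - Y l‖ ^ 2) / η) ((Pi.single j 1 : Fin n → ℝ) l / η) t := by
      simp only [Pi.add_apply, Pi.smul_apply, smul_eq_mul]
      simpa using ((((hasDerivAt_id t).mul_const ((Pi.single j 1 : Fin n → ℝ) l)).const_add
        (g l)).sub_const (‖x - Y l‖ ^ 2)).div_const η
    exact h0.exp
  have h2 := HasDerivAt.fun_sum (u := Finset.univ) fun l _ => h1 l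
  have hS := (partitionSum_pos hn η Y (g + t • Pi.single j 1) x).ne'
  have h3 := (h2.log hS).const_mul (-η)
  refine h3.congr_deriv ?_
  have : ∑ l, Real.exp (((g + t • (Pi.single j 1 : Fin n → ℝ)) l - ‖x - Y l‖ ^ 2) / η) *
        ((Pi.single j 1 : Fin n → ℝ) l / η) =
      Real.exp (((g + t • (Pi.single j 1 : Fin n → ℝ)) j - ‖x - Y j‖ ^ 2) / η) / η := by
    rw [Finset.sum_eq_single j]
    · simp only [Pi.single_eq_same]; ring
    · intro l _ hl
      simp [Pi.single_eq_of_ne hl]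
    · simp
  rw [this, softArgmin]
  change -η * (_ / partitionSum η Y (g + t • Pi.single j 1) x) = _
  field_simp

theorem integrable_softMin (hn : 0 < n) {η : ℝ} (hη : 0 < η) {Y : Fin n → E m}
    {P : Measure (E m)} [IsFiniteMeasure P] {R : ℝ} (hR : ∀ᵐ x ∂P, ∀ j, ‖x - Y j‖ ^ 2 ≤ R)
    (g : Fin n → ℝ) : Integrable (softMin η Y g) P := by
  set C := R + ∑ j, |g j| with hC
  refine Integrable.of_bound (C := C + η * Real.log n)
    (measurable_softMin η Y g).aestronglyMeasurable ?_
  filter_upwards [hR] with x hx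
  have hg : ∀ j, |g j| ≤ ∑ j, |g j| := fun j =>
    Finset.single_le_sum (f := fun j => |g j|) (fun _ _ => abs_nonneg _) (Finset.mem_univ j)
  have hb : ∀ j, |‖x - Y j‖ ^ 2 - g j| ≤ C := fun j => by
    have := abs_le.1 (hg j)
    have := hx j
    rw [abs_le, hC]
    constructor <;> nlinarith [sq_nonneg ‖x - Y j‖]
  have hlog : 0 ≤ η * Real.log n := mul_nonneg hη.le (Real.log_natCast_nonneg n)
  rw [Real.norm_eq_abs, abs_le]
  constructor
  · have h1 := sum_softArgmin_mul_le hn hη Y g x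
    have h2 : -C ≤ ∑ j, softArgmin η Y g x j * (‖x - Y j‖ ^ 2 - g j) := by
      have : ∑ j, softArgmin η Y g x j * (-C) = -C := by
        rw [← Finset.sum_mul, sum_softArgmin hn, one_mul]
      rw [← this]
      exact Finset.sum_le_sum fun j _ => mul_le_mul_of_nonneg_left (abs_le.1 (hb j)).1
        (softArgmin_nonneg hn η Y g x j)
    linarith
  · have h1 := softMin_le hη Y g x ⟨0, hn⟩
    have h2 := (abs_le.1 (hb ⟨0, hn⟩)).2
    linarith

/-- The smoothed and relaxed dual objective. -/
noncomputable def smoothDual (lam η : ℝ) (Y : Fin n → E m) (P : Measure (E m))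
    (g : Fin n → ℝ) : ℝ :=
  (∫ x, softMin η Y g x ∂P) - 1 / (lam * n) * ∑ j, Real.exp (-lam * g j)

theorem continuous_smoothDual (hn : 0 < n) {lam η : ℝ} (hη : 0 < η) {Y : Fin n → E m}
    {P : Measure (E m)} [IsProbabilityMeasure P] {R : ℝ}
    (hR : ∀ᵐ x ∂P, ∀ j, ‖x - Y j‖ ^ 2 ≤ R) : Continuous (smoothDual lam η Y P) := by
  refine Continuous.sub ?_ (by fun_prop)
  refine (LipschitzWith.of_le_add fun g g' => ?_).continuous
  have h : ∫ x, softMin η Y g x ∂P ≤ ∫ x, (softMin η Y g' x + dist g g') ∂P :=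
    integral_mono (integrable_softMin hn hη hR g)
      ((integrable_softMin hn hη hR g').add (integrable_const _))
      fun x => softMin_le_add hn hη Y g g' x
  rw [integral_add (integrable_softMin hn hη hR g') (integrable_const _)] at h
  simpa using h

/-- `h1` is invariant under adding constants to the potential, so its mean is not coercive. With the
exponential sum in place of its logarithm the invariance is gone: a large entry drives `softMin`
down, and a very negative one makes the exponential penalty dominate. -/
theorem exists_isMax_smoothDual (hn : 0 < n) {lam η : ℝ} (hl : 0 < lam) (hη : 0 < η)
    {Y : Fin n → E m} {P : Measure (E m)} [IsProbabilityMeasure P] {R : ℝ} (hR0 : 0 ≤ R)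
    (hR : ∀ᵐ x ∂P, ∀ j, ‖x - Y j‖ ^ 2 ≤ R) :
    ∃ g, ∀ g', smoothDual lam η Y P g' ≤ smoothDual lam η Y P g := by
  have hn' : (0 : ℝ) < n := by exact_mod_cast hn
  set a := smoothDual lam η Y P 0 with ha
  -- Outside this radius the objective falls below its value `a` at 0. An entry above `R + |a|`
  -- suffices by itself. For an entry `-u` with `u > 4 n / λ`, the bound `exp (λ u) ≥ (λ u)² / 2`
  -- makes the penalty at least `2 u`, so the objective is at most `R - u`.
  set r := max (R + |a|) (4 * n / lam) with hr
  have hr0 : 0 ≤ r := le_max_of_le_left (by positivity)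
  have hle : ∀ g j, smoothDual lam η Y P g ≤ R - g j - 1 / (lam * n) * Real.exp (-lam * g j) := by
    intro g j
    have h1 : ∫ x, softMin η Y g x ∂P ≤ ∫ _, (R - g j) ∂P := by
      refine integral_mono_ae (integrable_softMin hn hη hR g) (integrable_const _) ?_
      filter_upwards [hR] with x hx
      have := softMin_le hη Y g x j
      have := hx j
      linarith
    have h2 : Real.exp (-lam * g j) ≤ ∑ j, Real.exp (-lam * g j) :=
      Finset.single_le_sum (f := fun j => Real.exp (-lam * g j))
        (fun _ _ => (Real.exp_pos _).le) (Finset.mem_univ j)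
    have h3 := mul_le_mul_of_nonneg_left h2 (by positivity : 0 ≤ 1 / (lam * n))
    simp only [integral_const, probReal_univ, smul_eq_mul, one_mul] at h1
    unfold smoothDual
    linarith
  have hout : ∀ g, r < ‖g‖ → smoothDual lam η Y P g ≤ a := by
    intro g hg
    obtain ⟨j, hj⟩ : ∃ j, r < |g j| := by
      by_contra! hcon
      exact absurd ((pi_norm_le_iff_of_nonneg hr0).2 fun j => hcon j) (not_le.2 hg)
    have hr1 : R + |a| ≤ r := le_max_left _ _
    have hr2 : 4 * n / lam ≤ r := le_max_right _ _
    refine (hle g j).trans ?_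
    have ha' := neg_abs_le a
    rcases lt_abs.1 hj with h | h
    · have : 0 ≤ 1 / (lam * n) * Real.exp (-lam * g j) := by positivity
      linarith
    · set u := -g j with hu
      have hu0 : 0 < u := hr0.trans_lt h
      have h1 : (lam * u) ^ 2 / 2 ≤ Real.exp (lam * u) := by
        have := Real.quadratic_le_exp_of_nonneg (mul_pos hl hu0).le
        nlinarith [mul_pos hl hu0]
      have h2 : 2 * u ≤ 1 / (lam * n) * Real.exp (-lam * g j) := by
        have e : -lam * g j = lam * u := by rw [hu]; ring
        rw [e]
        refine le_trans ?_ (mul_le_mul_of_nonneg_left h1 (by positivity))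
        have h3 : 4 * n ≤ lam * u := by
          rw [div_le_iff₀ hl] at hr2
          nlinarith
        have e2 : 1 / (lam * n) * ((lam * u) ^ 2 / 2) = (lam * u) * u / (2 * n) := by
          field_simp
        rw [e2, le_div_iff₀ (by positivity)]
        nlinarith
      linarith
  obtain ⟨g, hg, hmax⟩ := (isCompact_closedBall (0 : Fin n → ℝ) r).exists_isMaxOn
    ⟨0, Metric.mem_closedBall_self hr0⟩ (continuous_smoothDual (lam := lam) hn hη hR).continuousOn
  refine ⟨g, fun g' => ?_⟩
  by_cases h : ‖g'‖ ≤ r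
  · exact hmax (by simpa using h)
  · exact (hout g' (not_le.1 h)).trans (hmax (Metric.mem_closedBall_self hr0))

/-- Differentiation under the integral is dominated by the constant 1, because the derivative is
minus a conditional probability. -/
theorem hasDerivAt_integral_softMin (hn : 0 < n) {η : ℝ} (hη : 0 < η) {Y : Fin n → E m}
    {P : Measure (E m)} [IsProbabilityMeasure P] {R : ℝ}
    (hR : ∀ᵐ x ∂P, ∀ j, ‖x - Y j‖ ^ 2 ≤ R) (g : Fin n → ℝ) (j : Fin n) :
    HasDerivAt (fun t : ℝ => ∫ x, softMin η Y (g + t • Pi.single j 1) x ∂P)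
      (-∫ x, softArgmin η Y g x j ∂P) 0 := by
  have hd : ∀ x t, HasDerivAt (fun t : ℝ => softMin η Y (g + t • Pi.single j 1) x)
      (-softArgmin η Y (g + t • Pi.single j 1) x j) t :=
    fun x t => hasDerivAt_softMin hn hη Y g x j t
  generalize (Pi.single j 1 : Fin n → ℝ) = v at hd ⊢
  have hm : ∀ t : ℝ, AEStronglyMeasurable (softMin η Y (g + t • v)) P :=
    fun t => (measurable_softMin η Y _).aestronglyMeasurable
  have hi : Integrable (softMin η Y (g + (0 : ℝ) • v)) P :=
    integrable_softMin hn hη hR _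
  have hm' : AEStronglyMeasurable (fun x => -softArgmin η Y (g + (0 : ℝ) • v) x j) P :=
    (measurable_softArgmin η Y _ j).neg.aestronglyMeasurable
  have hb : ∀ x (t : ℝ), ‖-softArgmin η Y (g + t • v) x j‖ ≤ 1 := fun x t => by
    rw [norm_neg, Real.norm_eq_abs, abs_of_nonneg (softArgmin_nonneg hn η Y _ x j)]
    exact softArgmin_le_one hn η Y _ x j
  have h := (hasDerivAt_integral_of_dominated_loc_of_deriv_le (μ := P) (x₀ := (0 : ℝ))
    (s := Set.univ) (F := fun t x => softMin η Y (g + t • v) x)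
    (F' := fun t x => -softArgmin η Y (g + t • v) x j) (bound := fun _ => 1)
    Filter.univ_mem (Filter.Eventually.of_forall hm) hi hm'
    (Filter.Eventually.of_forall fun x t _ => hb x t) (integrable_const _)
    (Filter.Eventually.of_forall fun x t _ => hd x t)).2
  rw [integral_neg, zero_smul, add_zero] at h
  exact h

theorem hasDerivAt_sum_exp (lam : ℝ) (g : Fin n → ℝ) (j : Fin n) :
    HasDerivAt (fun t : ℝ => ∑ l, Real.exp (-lam * (g + t • (Pi.single j 1 : Fin n → ℝ)) l))
      (Real.exp (-lam * g j) * -lam) 0 := by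
  have h1 : ∀ l, HasDerivAt (fun t : ℝ =>
      Real.exp (-lam * (g + t • (Pi.single j 1 : Fin n → ℝ)) l))
      (Real.exp (-lam * g l) * (-lam * (Pi.single j 1 : Fin n → ℝ) l)) 0 := by
    intro l
    have h0 : HasDerivAt (fun t : ℝ => -lam * (g l + t * (Pi.single j 1 : Fin n → ℝ) l))
        (-lam * (Pi.single j 1 : Fin n → ℝ) l) 0 := by
      simpa using (((hasDerivAt_id (0 : ℝ)).mul_const
        ((Pi.single j 1 : Fin n → ℝ) l)).const_add (g l)).const_mul (-lam)
    have h2 := h0.exp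
    rw [zero_mul, add_zero] at h2
    exact h2
  refine (HasDerivAt.fun_sum (u := Finset.univ) fun l _ => h1 l).congr_deriv ?_
  rw [Finset.sum_eq_single j]
  · simp
  · intro l _ hl
    simp [Pi.single_eq_of_ne hl]
  · simp

/-- At a maximizer of the smoothed dual the two marginals on the data points agree. -/
theorem exists_balanced_potential (hn : 0 < n) {lam η : ℝ} (hl : 0 < lam) (hη : 0 < η)
    {Y : Fin n → E m} {P : Measure (E m)} [IsProbabilityMeasure P] {R : ℝ} (hR0 : 0 ≤ R)
    (hR : ∀ᵐ x ∂P, ∀ j, ‖x - Y j‖ ^ 2 ≤ R) :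
    ∃ g : Fin n → ℝ, ∀ j, ∫ x, softArgmin η Y g x j ∂P = (1 / n : ℝ) * Real.exp (-lam * g j) := by
  obtain ⟨g, hg⟩ := exists_isMax_smoothDual hn hl hη hR0 hR
  have hn' : (0 : ℝ) < n := by exact_mod_cast hn
  refine ⟨g, fun j => ?_⟩
  have hd : HasDerivAt (fun t : ℝ => smoothDual lam η Y P (g + t • Pi.single j 1))
      (-(∫ x, softArgmin η Y g x j ∂P) - 1 / (lam * n) * (Real.exp (-lam * g j) * -lam)) 0 :=
    (hasDerivAt_integral_softMin hn hη hR g j).fun_sub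
      ((hasDerivAt_sum_exp lam g j).const_mul (1 / (lam * n)))
  have hmax : IsLocalMax (fun t : ℝ => smoothDual lam η Y P (g + t • Pi.single j 1)) 0 :=
    Filter.Eventually.of_forall fun t => by
      beta_reduce
      rw [zero_smul, add_zero]
      exact hg _
  have h0 := hmax.hasDerivAt_eq_zero hd
  have e : 1 / (lam * n) * (Real.exp (-lam * g j) * -lam) = -(1 / n * Real.exp (-lam * g j)) := by
    field_simp
  rw [e] at h0
  linarith

end Smoothing

/-! ### Strong duality from the entropic plan. -/

section StrongDuality

variable {m n : ℕ}

theorem lintegral_empirical (Y : Fin n → E m) {f : E m → ℝ≥0∞} (hf : Measurable f) :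
    ∫⁻ y, f y ∂(empirical Y) = ∑ j, (n : ℝ≥0∞)⁻¹ * f (Y j) := by
  rw [empirical, lintegral_finsetSum_measure]
  refine Finset.sum_congr rfl fun j _ => ?_
  rw [lintegral_smul_measure, lintegral_dirac' _ hf, smul_eq_mul]

/-- The joint law of `x ∼ P` and of the data point `Y_j`, drawn with probability `κ x j`. -/
noncomputable def plan (P : Measure (E m)) (Y : Fin n → E m) (κ : E m → Fin n → ℝ) :
    Measure (E m × E m) :=
  ∑ j, (P.withDensity fun x => ENNReal.ofReal (κ x j)).map fun x => (x, Y j)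

theorem lintegral_plan (P : Measure (E m)) (Y : Fin n → E m) {κ : E m → Fin n → ℝ}
    (hκ : ∀ j, Measurable fun x => κ x j) {f : E m × E m → ℝ≥0∞} (hf : Measurable f) :
    ∫⁻ p, f p ∂(plan P Y κ) = ∑ j, ∫⁻ x, ENNReal.ofReal (κ x j) * f (x, Y j) ∂P := by
  rw [plan, lintegral_finsetSum_measure]
  refine Finset.sum_congr rfl fun j _ => ?_
  rw [lintegral_map hf (by fun_prop),
    lintegral_withDensity_eq_lintegral_mul _ (hκ j).ennreal_ofReal (by fun_prop)]
  rfl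

/-- The row sums of `κ` give the first marginal. `hbal` gives each index the mass it carries in the
tilted empirical measure, already normalized by `hmass`. Testing against functions rather than
comparing point masses makes coinciding data points harmless. -/
theorem plan_mem_couplings (hn : 0 < n) {P : Measure (E m)} [IsProbabilityMeasure P]
    {Y : Fin n → E m} {κ : E m → Fin n → ℝ} (hκ : ∀ j, Measurable fun x => κ x j)
    (h0 : ∀ x j, 0 ≤ κ x j) (h1 : ∀ x, ∑ j, κ x j = 1) {f : E m → ℝ} (hf : Measurable f)
    (hmass : ∑ j, (1 / (n : ℝ)) * Real.exp (f (Y j)) = 1)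
    (hint : ∀ j, Integrable (fun x => κ x j) P)
    (hbal : ∀ j, ∫ x, κ x j ∂P = (1 / n : ℝ) * Real.exp (f (Y j))) :
    plan P Y κ ∈ couplings P ((empirical Y).tilted f) := by
  have hn' : (0 : ℝ) < n := by exact_mod_cast hn
  constructor
  · refine Measure.ext_of_lintegral _ fun φ hφ => ?_
    rw [lintegral_map hφ measurable_fst, lintegral_plan P Y hκ (by fun_prop),
      ← lintegral_finsetSum (f := fun j x => ENNReal.ofReal (κ x j) * φ x) _
        fun j _ => (hκ j).ennreal_ofReal.mul hφ]
    refine lintegral_congr fun x => ?_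
    rw [← Finset.sum_mul, ← ENNReal.ofReal_sum_of_nonneg fun j _ => h0 x j, h1]
    simp
  · refine Measure.ext_of_lintegral _ fun φ hφ => ?_
    rw [lintegral_map hφ measurable_snd, lintegral_plan P Y hκ (by fun_prop), lintegral_tilted,
      integral_empirical hn, hmass, lintegral_empirical Y (by fun_prop)]
    refine Finset.sum_congr rfl fun j _ => ?_
    simp only
    rw [lintegral_mul_const _ (hκ j).ennreal_ofReal,
      ← ofReal_integral_eq_lintegral_ofReal (hint j) (Filter.Eventually.of_forall fun x => h0 x j),
      hbal, ENNReal.ofReal_mul (by positivity), div_one, one_div, ENNReal.ofReal_inv_of_pos hn',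
      ENNReal.ofReal_natCast, mul_assoc]

/-- The relative entropy of a normalized tilted measure. -/
theorem klDiv_tilted_self {α : Type*} [MeasurableSpace α] {ν : Measure α}
    [IsProbabilityMeasure ν] {f : α → ℝ} (hf : Measurable f) {K : ℝ} (hK : ∀ x, |f x| ≤ K)
    (h1 : ∫ x, Real.exp (f x) ∂ν = 1) :
    InformationTheory.klDiv (ν.tilted f) ν = ENNReal.ofReal (∫ x, f x ∂(ν.tilted f)) ∧
      0 ≤ ∫ x, f x ∂(ν.tilted f) := by
  have hfν : Integrable (fun x => Real.exp (f x)) ν := by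
    by_contra h
    rw [integral_undef h] at h1
    exact zero_ne_one h1
  have : IsProbabilityMeasure (ν.tilted f) := isProbabilityMeasure_tilted hfν
  have hac := tilted_absolutelyContinuous ν f
  have hll : llr (ν.tilted f) ν =ᵐ[ν.tilted f] f := by
    refine hac.ae_le ((log_rnDeriv_tilted_left_self hfν).trans ?_)
    rw [h1]
    simp
  have hint : Integrable (llr (ν.tilted f) ν) (ν.tilted f) :=
    (Integrable.of_bound (C := K) hf.aestronglyMeasurable
      (Filter.Eventually.of_forall hK)).congr hll.symm
  have e : ∫ x, llr (ν.tilted f) ν x ∂(ν.tilted f) = ∫ x, f x ∂(ν.tilted f) :=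
    integral_congr_ae hll
  have hg := InformationTheory.integral_llr_add_sub_measure_univ_nonneg hac hint
  rw [InformationTheory.klDiv_of_ac_of_integrable hac hint, e]
  rw [e] at hg
  simp only [probReal_univ, add_sub_cancel_right] at hg ⊢
  exact ⟨trivial, hg⟩

/-- At a balanced potential the entropic plan is a feasible competitor. Its second marginal `Q` has
`KL / λ` equal to minus the `Q`-mean of the potential, so the primal value is at most the plan
average of the gaps, which is within `η log n` of the mean minimum. The logarithm in `h1` vanishes
by normalization. -/
theorem exists_ell_le_smooth (hn : 0 < n) {lam η : ℝ} (hl : 0 < lam) (hη : 0 < η)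
    {Y : Fin n → E m} {P : Measure (E m)} [IsProbabilityMeasure P] {R : ℝ} (hR0 : 0 ≤ R)
    (hR : ∀ᵐ x ∂P, ∀ j, ‖x - Y j‖ ^ 2 ≤ R) :
    ∃ g : Fin n → ℝ, 0 ≤ (∫ x, h1 lam Y x g ∂P) + η * Real.log n ∧ ell lam (empirical Y) P ≤
      ENNReal.ofReal ((∫ x, h1 lam Y x g ∂P) + η * Real.log n) := by
  obtain ⟨g, hg⟩ := exists_balanced_potential hn hl hη hR0 hR
  have := isProbabilityMeasure_empirical hn Y
  have hn' : (0 : ℝ) < n := by exact_mod_cast hn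
  refine ⟨g, ?_⟩
  -- For coinciding data points the soft-argmin masses have ratio `exp ((g j - g k) / η)`, while
  -- balance demands `exp (-λ (g j - g k))`; the opposite signs force equality. Hence the potential
  -- is a function on the data.
  have hsymm : ∀ j k, Y j = Y k → g j = g k := by
    intro j k hjk
    have e1 : ∀ x, softArgmin η Y g x j = Real.exp ((g j - g k) / η) * softArgmin η Y g x k := by
      intro x
      rw [softArgmin, softArgmin, ← mul_div_assoc, ← Real.exp_add, hjk]
      ring_nf
    have e2 := hg j
    simp only [e1] at e2
    rw [integral_const_mul, hg k, mul_left_comm, ← Real.exp_add] at e2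
    have e3 := Real.exp_injective (mul_left_cancel₀ (by positivity) e2)
    have e4 : (g j - g k) * (1 / η + lam) = 0 := by
      rw [div_eq_mul_one_div] at e3
      linarith
    rcases mul_eq_zero.1 e4 with h | h
    · linarith
    · have : 0 < 1 / η + lam := by positivity
      linarith
  obtain ⟨f, hf, ⟨K, hK⟩, -, hfg⟩ := exists_extended_potential Y g
  have hfY : ∀ j, f (Y j) = g j := fun j => by
    obtain ⟨k, hk, hfk⟩ := hfg j
    rw [hfk, hsymm k j hk]
  have hint : ∀ j, Integrable (fun x => softArgmin η Y g x j) P := fun j =>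
    integrable_softArgmin hn η Y g j P
  -- Summing the balance equations over `j` normalizes the weights: the conditional probabilities
  -- sum to 1.
  have hmass : ∑ j, (1 / (n : ℝ)) * Real.exp (-lam * g j) = 1 := by
    simp only [← hg]
    rw [← integral_finsetSum _ fun j _ => hint j]
    simp [sum_softArgmin hn]
  have hfm : Measurable fun y => -lam * f y := hf.const_mul _
  set Q := (empirical Y).tilted fun y => -lam * f y with hQ
  have hexp : ∫ y, Real.exp (-lam * f y) ∂(empirical Y) = 1 := by
    rw [integral_empirical hn]
    simpa only [hfY] using hmass
  obtain ⟨hkl, hkl0⟩ := klDiv_tilted_self (ν := empirical Y) hfm (K := lam * K) (fun y => by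
      rw [abs_mul, abs_neg, abs_of_pos hl]
      exact mul_le_mul_of_nonneg_left (hK y) hl.le) hexp
  have hQP : IsProbabilityMeasure Q := by
    refine isProbabilityMeasure_tilted ?_
    by_contra h
    rw [integral_undef h] at hexp
    exact zero_ne_one hexp
  have hentropy : ∫ y, -lam * f y ∂Q = ∑ j, ∫ x, softArgmin η Y g x j * (-lam * g j) ∂P := by
    rw [hQ, integral_tilted, hexp, integral_empirical hn]
    refine Finset.sum_congr rfl fun j _ => ?_
    rw [integral_mul_const, hg, hfY, smul_eq_mul]
    ring
  have hcouple : plan P Y (softArgmin η Y g) ∈ couplings P Q :=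
    plan_mem_couplings hn (measurable_softArgmin η Y g) (softArgmin_nonneg hn η Y g)
      (sum_softArgmin hn η Y g) hfm (by simpa only [hfY] using hmass) hint
      (fun j => by simpa only [hfY] using hg j)
  have hcint : ∀ j, Integrable (fun x => softArgmin η Y g x j * ‖x - Y j‖ ^ 2) P := by
    intro j
    refine Integrable.of_bound (C := R)
      ((measurable_softArgmin η Y g j).mul (by fun_prop)).aestronglyMeasurable ?_
    filter_upwards [hR] with x hx
    rw [norm_mul, Real.norm_eq_abs, Real.norm_eq_abs, abs_of_nonneg (softArgmin_nonneg hn η Y g x j),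
      abs_of_nonneg (sq_nonneg _)]
    calc _ ≤ 1 * R := mul_le_mul (softArgmin_le_one hn η Y g x j) (hx j) (sq_nonneg _) zero_le_one
      _ = R := one_mul R
  have hcost : ∫⁻ p, ‖p.1 - p.2‖ₑ ^ 2 ∂(plan P Y (softArgmin η Y g)) =
      ENNReal.ofReal (∑ j, ∫ x, softArgmin η Y g x j * ‖x - Y j‖ ^ 2 ∂P) := by
    rw [lintegral_plan P Y (measurable_softArgmin η Y g) (by fun_prop),
      ENNReal.ofReal_sum_of_nonneg fun j _ => integral_nonneg fun x =>
        mul_nonneg (softArgmin_nonneg hn η Y g x j) (sq_nonneg _)]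
    refine Finset.sum_congr rfl fun j _ => ?_
    rw [ofReal_integral_eq_lintegral_ofReal (hcint j) (Filter.Eventually.of_forall fun x =>
        mul_nonneg (softArgmin_nonneg hn η Y g x j) (sq_nonneg _))]
    refine lintegral_congr fun x => ?_
    rw [ENNReal.ofReal_mul (softArgmin_nonneg hn η Y g x j),
      ENNReal.ofReal_pow (norm_nonneg _), ofReal_norm]
  have hcost0 : 0 ≤ ∑ j, ∫ x, softArgmin η Y g x j * ‖x - Y j‖ ^ 2 ∂P :=
    Finset.sum_nonneg fun j _ => integral_nonneg fun x =>
        mul_nonneg (softArgmin_nonneg hn η Y g x j) (sq_nonneg _)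
  have hle : 1 / lam * (∫ y, -lam * f y ∂Q) +
      ∑ j, ∫ x, softArgmin η Y g x j * ‖x - Y j‖ ^ 2 ∂P ≤
        (∫ x, h1 lam Y x g ∂P) + η * Real.log n := by
    have hφ := integrable_iInf_cost hn hR g
    have hi : ∀ j, Integrable (fun x => softArgmin η Y g x j * (‖x - Y j‖ ^ 2 - g j)) P :=
      fun j => (((hcint j).sub ((hint j).mul_const (g j)))).congr
        (Filter.Eventually.of_forall fun x => by simp only [Pi.sub_apply]; ring)
    have e1 : 1 / lam * (∫ y, -lam * f y ∂Q) +
        ∑ j, ∫ x, softArgmin η Y g x j * ‖x - Y j‖ ^ 2 ∂P =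
        ∫ x, ∑ j, softArgmin η Y g x j * (‖x - Y j‖ ^ 2 - g j) ∂P := by
      rw [hentropy, integral_finsetSum _ fun j _ => hi j, Finset.mul_sum,
        ← Finset.sum_add_distrib]
      refine Finset.sum_congr rfl fun j _ => ?_
      simp only [mul_sub]
      rw [integral_sub (hcint j) ((hint j).mul_const _), integral_mul_const,
        integral_mul_const]
      field_simp
      ring
    have e2 : ∫ x, h1 lam Y x g ∂P = ∫ x, ⨅ j, (‖x - Y j‖ ^ 2 - g j) ∂P := by
      simp only [h1_eq, logMean, hmass, Real.log_one, mul_zero, sub_zero]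
    have e3 : (∫ x, ⨅ j, (‖x - Y j‖ ^ 2 - g j) ∂P) + η * Real.log n =
        ∫ x, ((⨅ j, (‖x - Y j‖ ^ 2 - g j)) + η * Real.log n) ∂P := by
      rw [integral_add hφ (integrable_const _)]
      simp
    rw [e1, e2, e3]
    refine integral_mono (integrable_finsetSum _ fun j _ => hi j)
      (hφ.add (integrable_const _)) fun x => ?_
    have : Nonempty (Fin n) := ⟨⟨0, hn⟩⟩
    refine (sum_softArgmin_mul_le hn hη Y g x).trans ?_
    gcongr
    exact le_ciInf fun j => softMin_le hη Y g x j
  refine ⟨(add_nonneg (mul_nonneg (by positivity) hkl0) hcost0).trans hle, ?_⟩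
  calc ell lam (empirical Y) P
      ≤ ENNReal.ofReal (1 / lam) * InformationTheory.klDiv Q (empirical Y) + W2 P Q ^ 2 :=
        iInf_le_of_le Q (iInf_le_of_le hQP (iInf_le _ (tilted_absolutelyContinuous _ _)))
    _ ≤ ENNReal.ofReal (1 / lam) * ENNReal.ofReal (∫ y, -lam * f y ∂Q) +
          ENNReal.ofReal (∑ j, ∫ x, softArgmin η Y g x j * ‖x - Y j‖ ^ 2 ∂P) := by
        rw [hkl, ← hcost, W2_sq]
        gcongr
        exact iInf₂_le _ hcouple
    _ = ENNReal.ofReal (1 / lam * (∫ y, -lam * f y ∂Q) +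
          ∑ j, ∫ x, softArgmin η Y g x j * ‖x - Y j‖ ^ 2 ∂P) := by
        rw [← ENNReal.ofReal_mul (by positivity),
          ← ENNReal.ofReal_add (mul_nonneg (by positivity) hkl0) hcost0]
    _ ≤ ENNReal.ofReal ((∫ x, h1 lam Y x g ∂P) + η * Real.log n) :=
        ENNReal.ofReal_le_ofReal hle

/-- Strong duality, with near-optimal potentials valued in `[0, R]`. -/
theorem exists_ell_le (hn : 0 < n) {lam δ : ℝ} (hl : 0 < lam) (hδ : 0 < δ)
    {Y : Fin n → E m} {P : Measure (E m)} [IsProbabilityMeasure P] {R : ℝ} (hR0 : 0 ≤ R)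
    (hR : ∀ᵐ x ∂P, ∀ j, ‖x - Y j‖ ^ 2 ≤ R) :
    ∃ g : Fin n → ℝ, (∀ j, 0 ≤ g j ∧ g j ≤ R) ∧
      ell lam (empirical Y) P ≠ ∞ ∧
      (ell lam (empirical Y) P).toReal ≤ (∫ x, h1 lam Y x g ∂P) + δ := by
  have hlog : 0 ≤ Real.log n := Real.log_natCast_nonneg n
  -- This temperature gives `η log n ≤ δ`; the added 1 avoids a zero denominator when `n = 1`.
  obtain ⟨g, hg0, hg⟩ := exists_ell_le_smooth hn hl (η := δ / (Real.log n + 1)) (by positivity) hR0 hR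
  obtain ⟨g', hg', hle⟩ := exists_bounded_potential hn hl Y hR0 g
  refine ⟨g', hg', ne_top_of_le_ne_top ENNReal.ofReal_ne_top hg,
    (ENNReal.toReal_le_of_le_ofReal hg0 hg).trans ?_⟩
  have hi : ∀ g, Integrable (fun x => h1 lam Y x g) P := fun g =>
    (integrable_iInf_cost hn hR g).sub (integrable_const _)
  refine add_le_add (integral_mono_ae (hi g) (hi g') ?_) ?_
  · filter_upwards [hR] with x hx
    exact hle x hx
  · rw [div_mul_eq_mul_div, div_le_iff₀ (by positivity)]
    nlinarith

end StrongDuality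

/-! ### Orthogonality of martingale differences for independent samples. -/

section Martingale

variable {α Ω : Type*} [MeasurableSpace α] [MeasurableSpace Ω] {P : Measure α} {μ : Measure Ω}
  {X : ℕ → Ω → α} {s : ℕ}

/-- A function of `X_0, …, X_k` whose average over the last variable vanishes has mean zero. -/
theorem integral_eq_zero_of_integral_update [Nonempty α] [IsProbabilityMeasure P]
    [IsProbabilityMeasure μ] (hX : ∀ i < s, HasLaw (X i) P μ)
    (hind : iIndepFun (fun i : Fin s => X i) μ) {k : ℕ} (hk : k < s) {T : (ℕ → α) → ℝ}
    (hT : Measurable T) (hdep : DependsOn T (Set.Iic k))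
    (hint : Integrable (fun ω => T fun i => X i ω) μ)
    (h0 : ∀ x, ∫ y, T (Function.update x k y) ∂P = 0) :
    ∫ ω, T (fun i => X i ω) ∂μ = 0 := by
  classical
  have a₀ : α := Classical.arbitrary α
  let S : Finset (Fin s) := Finset.univ.filter fun i => (i : ℕ) < k
  let k' : Fin s := ⟨k, hk⟩
  have hdisj : Disjoint S {k'} := by simp [S, k']
  have hae : ∀ i : Fin s, AEMeasurable (X i) μ := fun i => (hX i i.2).aemeasurable
  have h1 := hind.indepFun_finset₀ S {k'} hdisj hae
  -- The samples before `k` are padded to a full sequence by an arbitrary point. This is harmless,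
  -- since coordinate `k` is overwritten and `T` ignores the later ones, and it uses independence
  -- only among the first `s` variables.
  let ext : (S → α) → ℕ → α := fun u i =>
    if h : ∃ hi : i < s, (⟨i, hi⟩ : Fin s) ∈ S then u ⟨⟨i, h.1⟩, h.2⟩ else a₀
  have hext : Measurable ext := by
    refine measurable_pi_lambda _ fun i => ?_
    by_cases h : ∃ hi : i < s, (⟨i, hi⟩ : Fin s) ∈ S
    · simp only [ext, h, dite_true]; exact measurable_pi_apply _
    · simp only [ext, h, dite_false]; exact measurable_const
  have h2 := h1.comp hext (measurable_pi_apply (⟨k', by simp⟩ : ({k'} : Finset (Fin s))))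
  set A : Ω → ℕ → α := ext ∘ fun ω (i : S) => X i ω with hA
  have hAm : AEMeasurable A μ :=
    hext.comp_aemeasurable (aemeasurable_pi_lambda _ fun i => hae i)
  have h3 : IndepFun A (X k) μ := h2
  have hXk := (hX k hk).aemeasurable
  have heq : ∀ ω, T (fun i => X i ω) = T (Function.update (A ω) k (X k ω)) := by
    intro ω
    refine hdep fun i hi => ?_
    rcases (Set.mem_Iic.1 hi).lt_or_eq with h | rfl
    · have : ∃ hi : i < s, (⟨i, hi⟩ : Fin s) ∈ S := ⟨h.trans hk, by simp [S, h]⟩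
      simp [Function.update_of_ne h.ne, hA, ext, this]
    · simp
  have hup : Measurable fun p : (ℕ → α) × α => Function.update p.1 k p.2 := by
    refine measurable_pi_lambda _ fun i => ?_
    by_cases h : i = k
    · subst h; simpa using measurable_snd
    · simp only [Function.update_of_ne h]
      exact (measurable_pi_apply i).comp measurable_fst
  have hT' : Measurable fun p : (ℕ → α) × α => T (Function.update p.1 k p.2) := hT.comp hup
  have hlaw : μ.map (fun ω => (A ω, X k ω)) = (μ.map A).prod P := by
    rw [(indepFun_iff_map_prod_eq_prod_map_map hAm hXk).1 h3, (hX k hk).map_eq]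
  have hpair : AEMeasurable (fun ω => (A ω, X k ω)) μ := hAm.prodMk hXk
  simp only [heq] at hint ⊢
  have : IsProbabilityMeasure (μ.map A) := Measure.isProbabilityMeasure_map hAm
  have hint' : Integrable (fun p : (ℕ → α) × α => T (Function.update p.1 k p.2))
      ((μ.map A).prod P) := by
    rw [← hlaw]
    exact (integrable_map_measure hT'.aestronglyMeasurable hpair).2 hint
  rw [← integral_map (φ := fun ω => (A ω, X k ω))
    (f := fun p : (ℕ → α) × α => T (Function.update p.1 k p.2)) hpair hT'.aestronglyMeasurable,
    hlaw, integral_prod _ hint']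
  simp [h0]

/-- The second moment of a sum of bounded martingale differences. -/
theorem integral_sq_sum_le [Nonempty α] [IsProbabilityMeasure P]
    [IsProbabilityMeasure μ] (hXm : ∀ i, AEMeasurable (X i) μ) (hX : ∀ i < s, HasLaw (X i) P μ)
    (hind : iIndepFun (fun i : Fin s => X i) μ) {Z : ℕ → (ℕ → α) → ℝ} {b : ℕ → ℝ}
    (hZ : ∀ i, Measurable (Z i)) (hdep : ∀ i, DependsOn (Z i) (Set.Iic i))
    (hb : ∀ i < s, ∀ᵐ ω ∂μ, |Z i fun k => X k ω| ≤ b i)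
    (h0 : ∀ i x, ∫ y, Z i (Function.update x i y) ∂P = 0) {k : ℕ} (hk : k ≤ s) :
    ∫ ω, (∑ i ∈ Finset.range k, Z i fun k => X k ω) ^ 2 ∂μ ≤ ∑ i ∈ Finset.range k, b i ^ 2 := by
  have hXω : AEMeasurable (fun ω k => X k ω) μ := aemeasurable_pi_lambda _ hXm
  have hZm : ∀ i, AEStronglyMeasurable (fun ω => Z i fun k => X k ω) μ := fun i =>
    ((hZ i).comp_aemeasurable hXω).aestronglyMeasurable
  have hSb : ∀ k ≤ s, ∀ᵐ ω ∂μ, |∑ i ∈ Finset.range k, Z i fun k => X k ω| ≤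
      ∑ i ∈ Finset.range k, b i := by
    intro k hk
    have : ∀ᵐ ω ∂μ, ∀ i ∈ Finset.range k, |Z i fun k => X k ω| ≤ b i :=
      (Filter.eventually_all_finset _).2 fun i hi => hb i ((Finset.mem_range.1 hi).trans_le hk)
    filter_upwards [this] with ω hω
    exact (Finset.abs_sum_le_sum_abs _ _).trans (Finset.sum_le_sum hω)
  have hSm : ∀ k, AEStronglyMeasurable (fun ω => ∑ i ∈ Finset.range k, Z i fun k => X k ω) μ :=
    fun k => Finset.aestronglyMeasurable_fun_sum _ fun i _ => hZm i
  induction k with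
  | zero => simp
  | succ k ih =>
    have hks : k < s := hk
    have hi1 : Integrable (fun ω => (∑ i ∈ Finset.range k, Z i fun k => X k ω) ^ 2) μ := by
      refine Integrable.of_bound (C := (∑ i ∈ Finset.range k, b i) ^ 2) ((hSm k).pow 2) ?_
      filter_upwards [hSb k hks.le] with ω hω
      rw [Real.norm_eq_abs, abs_pow]
      exact pow_le_pow_left₀ (abs_nonneg _) hω 2
    have hi2 : Integrable (fun ω => (Z k fun k => X k ω) ^ 2) μ := by
      refine Integrable.of_bound (C := b k ^ 2) ((hZm k).pow 2) ?_
      filter_upwards [hb k hks] with ω hω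
      rw [Real.norm_eq_abs, abs_pow]
      exact pow_le_pow_left₀ (abs_nonneg _) hω 2
    have hi3 : Integrable (fun ω => (∑ i ∈ Finset.range k, Z i fun k => X k ω) *
        Z k fun k => X k ω) μ := by
      refine Integrable.of_bound (C := (∑ i ∈ Finset.range k, b i) * b k) ((hSm k).mul (hZm k)) ?_
      filter_upwards [hSb k hks.le, hb k hks] with ω hω hω'
      rw [Real.norm_eq_abs, abs_mul]
      exact mul_le_mul hω hω' (abs_nonneg _) ((abs_nonneg _).trans hω)
    -- The partial sum does not involve the last variable, so it factors out of the inner integral,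
    -- and the increment averages to zero.
    have hcross : ∫ ω, (∑ i ∈ Finset.range k, Z i fun k => X k ω) * (Z k fun k => X k ω) ∂μ = 0 := by
      refine integral_eq_zero_of_integral_update hX hind hks
        (T := fun x => (∑ i ∈ Finset.range k, Z i x) * Z k x)
        ((Finset.measurable_fun_sum _ fun i _ => hZ i).mul (hZ k)) ?_ hi3 fun x => ?_
      · intro x y hxy
        beta_reduce
        rw [hdep k hxy]
        congr 1
        refine Finset.sum_congr rfl fun i hi => hdep i fun j hj => hxy j ?_
        exact (Set.mem_Iic.1 hj).trans (Finset.mem_range.1 hi).le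
      · have : ∀ y, ∑ i ∈ Finset.range k, Z i (Function.update x k y) =
            ∑ i ∈ Finset.range k, Z i x := by
          intro y
          refine Finset.sum_congr rfl fun i hi => hdep i fun j hj => ?_
          exact Function.update_of_ne
            ((Set.mem_Iic.1 hj).trans_lt (Finset.mem_range.1 hi)).ne _ _
        simp only [this]
        rw [integral_const_mul, h0, mul_zero]
    have hZb : ∫ ω, (Z k fun k => X k ω) ^ 2 ∂μ ≤ b k ^ 2 := by
      have : ∫ ω, (Z k fun k => X k ω) ^ 2 ∂μ ≤ ∫ _, b k ^ 2 ∂μ := by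
        refine integral_mono_ae hi2 (integrable_const _) ?_
        filter_upwards [hb k hks] with ω hω
        exact sq_le_sq' (abs_le.1 hω).1 (abs_le.1 hω).2
      simpa using this
    have e : ∀ ω, (∑ i ∈ Finset.range (k + 1), Z i fun k => X k ω) ^ 2 =
        (∑ i ∈ Finset.range k, Z i fun k => X k ω) ^ 2 +
          2 * ((∑ i ∈ Finset.range k, Z i fun k => X k ω) * Z k fun k => X k ω) +
          (Z k fun k => X k ω) ^ 2 := fun ω => by
      rw [Finset.sum_range_succ]; ring
    have hi4 : Integrable (fun ω => (∑ i ∈ Finset.range k, Z i fun k => X k ω) ^ 2 +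
        2 * ((∑ i ∈ Finset.range k, Z i fun k => X k ω) * Z k fun k => X k ω)) μ :=
      hi1.add (hi3.const_mul 2)
    simp only [e]
    rw [integral_add hi4 hi2, integral_add hi1 (hi3.const_mul 2),
      integral_const_mul, hcross, Finset.sum_range_succ]
    linarith [ih hks.le]

/-- First moments follow from second moments by nonnegativity of the variance of the absolute value.
-/
theorem integral_abs_sum_le [Nonempty α] [IsProbabilityMeasure P]
    [IsProbabilityMeasure μ] (hXm : ∀ i, AEMeasurable (X i) μ) (hX : ∀ i < s, HasLaw (X i) P μ)
    (hind : iIndepFun (fun i : Fin s => X i) μ) {Z : ℕ → (ℕ → α) → ℝ} {b : ℕ → ℝ}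
    (hZ : ∀ i, Measurable (Z i)) (hdep : ∀ i, DependsOn (Z i) (Set.Iic i))
    (hb : ∀ i < s, ∀ᵐ ω ∂μ, |Z i fun k => X k ω| ≤ b i)
    (h0 : ∀ i x, ∫ y, Z i (Function.update x i y) ∂P = 0) :
    Integrable (fun ω => ∑ i ∈ Finset.range s, Z i fun k => X k ω) μ ∧
    ∫ ω, |∑ i ∈ Finset.range s, Z i fun k => X k ω| ∂μ ≤ √(∑ i ∈ Finset.range s, b i ^ 2) := by
  have hXω : AEMeasurable (fun ω k => X k ω) μ := aemeasurable_pi_lambda _ hXm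
  have hSm : AEStronglyMeasurable (fun ω => ∑ i ∈ Finset.range s, Z i fun k => X k ω) μ :=
    Finset.aestronglyMeasurable_fun_sum _ fun i _ =>
      ((hZ i).comp_aemeasurable hXω).aestronglyMeasurable
  have hSb : ∀ᵐ ω ∂μ, ‖∑ i ∈ Finset.range s, Z i fun k => X k ω‖ ≤ ∑ i ∈ Finset.range s, b i := by
    have : ∀ᵐ ω ∂μ, ∀ i ∈ Finset.range s, |Z i fun k => X k ω| ≤ b i :=
      (Filter.eventually_all_finset _).2 fun i hi => hb i (Finset.mem_range.1 hi)
    filter_upwards [this] with ω hω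
    exact (Finset.abs_sum_le_sum_abs _ _).trans (Finset.sum_le_sum hω)
  refine ⟨Integrable.of_bound hSm _ hSb, Real.le_sqrt_of_sq_le ?_⟩
  have hL : MemLp (fun ω => |∑ i ∈ Finset.range s, Z i fun k => X k ω|) 2 μ :=
    (MemLp.of_bound hSm _ hSb).abs
  have hv := variance_nonneg (fun ω => |∑ i ∈ Finset.range s, Z i fun k => X k ω|) μ
  rw [variance_eq_sub hL] at hv
  have h2 := integral_sq_sum_le hXm hX hind hZ hdep hb h0 le_rfl
  simp only [Pi.pow_apply, sq_abs] at hv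
  linarith

end Martingale

/-! ### From regret and fluctuation to the error of the estimate. -/

section Error

variable {m n : ℕ}

theorem measurable_h1 {β : Type*} [MeasurableSpace β] (lam : ℝ) (Y : Fin n → E m)
    {f : β → E m} {u : β → Fin n → ℝ} (hf : Measurable f) (hu : Measurable u) :
    Measurable fun b => h1 lam Y (f b) (u b) := by
  unfold h1
  have hu' : ∀ j, Measurable fun b => u b j := fun j => (measurable_pi_apply j).comp hu
  refine Measurable.sub (Measurable.iInf fun j => ?_) ?_
  · exact ((hf.sub_const (Y j)).norm.pow_const 2).sub (hu' j)
  · refine Measurable.const_mul (Measurable.log (Finset.measurable_fun_sum _ fun t _ => ?_)) _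
    exact ((hu' t).const_mul (-lam)).exp.const_mul _

theorem measurable_direction (lam : ℝ) (Y : Fin n → E m) :
    Measurable fun p : E m × (Fin n → ℝ) => direction lam Y p.1 p.2 := by
  classical
  refine measurable_pi_lambda _ fun j => ?_
  unfold direction
  refine Measurable.sub (by fun_prop) (Measurable.ite ?_ measurable_const measurable_const)
  simp only [IsFirstArgmin, Set.ofPred_and, Set.ofPred_forall]
  exact (MeasurableSet.iInter fun k => measurableSet_le (by fun_prop) (by fun_prop)).inter
    (MeasurableSet.iInter fun k => MeasurableSet.iInter fun _ =>
      measurableSet_lt (by fun_prop) (by fun_prop))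

theorem measurable_sgaIterate (lam B : ℝ) (Y : Fin n → E m) (g₀ : Fin n → ℝ) (i : ℕ) :
    Measurable fun x => sgaIterate lam B Y g₀ x i := by
  induction i with
  | zero => exact measurable_const
  | succ i ih =>
    have h : Measurable fun x : ℕ → E m =>
        direction lam Y (x i) (sgaIterate lam B Y g₀ x i) :=
      (measurable_direction lam Y).comp ((measurable_pi_apply i).prodMk ih)
    refine measurable_pi_lambda _ fun j => ?_
    exact ((measurable_pi_apply j).comp ih).add
      (((measurable_pi_apply j).comp h).const_mul _)

/-- Predictability: the iterate paired with sample `x i` uses strictly earlier samples only, hence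
`Set.Iio` where the increments have `Set.Iic`. -/
theorem dependsOn_sgaIterate (lam B : ℝ) (Y : Fin n → E m) (g₀ : Fin n → ℝ) (i : ℕ) :
    DependsOn (fun x => sgaIterate lam B Y g₀ x i) (Set.Iio i) := by
  induction i with
  | zero => intro x y _; rfl
  | succ i ih =>
    intro x y hxy
    have h := ih (x := x) (y := y) fun j hj => hxy j ((Set.mem_Iio.1 hj).trans (Nat.lt_succ_self i))
    beta_reduce at h ⊢
    rw [sgaIterate, sgaIterate, h, hxy i (Nat.lt_succ_self i)]

theorem dependsOn_sgaEstimate (lam B : ℝ) (Y : Fin n → E m) (g₀ : Fin n → ℝ) (s : ℕ) :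
    DependsOn (sgaEstimate lam B Y g₀ s) (Set.Iio s) := by
  intro x y hxy
  unfold sgaEstimate
  congr 1
  refine Finset.sum_congr rfl fun i hi => ?_
  have h := dependsOn_sgaIterate lam B Y g₀ i (x := x) (y := y) fun j hj =>
    hxy j ((Set.mem_Iio.1 hj).trans (Finset.mem_range.1 hi))
  beta_reduce at h
  rw [h, hxy i (Finset.mem_range.1 hi)]

theorem measurable_sgaEstimate (lam B : ℝ) (Y : Fin n → E m) (g₀ : Fin n → ℝ) (s : ℕ) :
    Measurable (sgaEstimate lam B Y g₀ s) := by
  unfold sgaEstimate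
  refine Measurable.const_mul (Finset.measurable_fun_sum _ fun i _ => Measurable.const_mul ?_ _) _
  exact measurable_h1 lam Y (measurable_pi_apply i) (measurable_sgaIterate lam B Y g₀ i)

theorem integrable_h1 (hn : 0 < n) (lam : ℝ) {Y : Fin n → E m} {P : Measure (E m)}
    [IsFiniteMeasure P] {R : ℝ} (hR : ∀ᵐ x ∂P, ∀ j, ‖x - Y j‖ ^ 2 ≤ R) (g : Fin n → ℝ) :
    Integrable (fun x => h1 lam Y x g) P :=
  (integrable_iInf_cost hn hR g).sub (integrable_const _)

/-- At a fixed potential the logarithmic terms cancel, and costs in `[0, R]` move the minimum by at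
most `R`. The bound is uniform in `g`, so the iterates need no a priori bound. -/
theorem abs_h1_sub_integral_le (hn : 0 < n) (lam : ℝ) {Y : Fin n → E m} {P : Measure (E m)}
    [IsProbabilityMeasure P] {R : ℝ} (hR : ∀ᵐ x ∂P, ∀ j, ‖x - Y j‖ ^ 2 ≤ R) (g : Fin n → ℝ)
    {x : E m} (hx : ∀ j, ‖x - Y j‖ ^ 2 ≤ R) :
    |h1 lam Y x g - ∫ y, h1 lam Y y g ∂P| ≤ R := by
  have hi := integrable_h1 hn lam hR g
  have hu : ∫ y, h1 lam Y y g ∂P ≤ ∫ _, (h1 lam Y x g + R) ∂P := by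
    refine integral_mono_ae hi (integrable_const _) ?_
    filter_upwards [hR] with y hy
    have := iInf_cost_sub_le hn (x := y) (y := x) (R := R)
      (fun j => (hy j).trans (by nlinarith [sq_nonneg ‖x - Y j‖])) g
    simp only [h1_eq]
    linarith
  have hd : ∫ _, (h1 lam Y x g - R) ∂P ≤ ∫ y, h1 lam Y y g ∂P := by
    refine integral_mono_ae (integrable_const _) hi ?_
    filter_upwards with y
    have := iInf_cost_sub_le hn (x := x) (y := y) (R := R)
      (fun j => (hx j).trans (by nlinarith [sq_nonneg ‖y - Y j‖])) g
    simp only [h1_eq]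
    linarith
  simp only [integral_const, probReal_univ, smul_eq_mul, one_mul] at hu hd
  rw [abs_le]
  constructor <;> linarith

/-- The expected fluctuation of the weighted values of `h1` at predictable potentials. -/
theorem integral_abs_sum_h1_sub_le {Ω : Type*} [MeasurableSpace Ω] {μ : Measure Ω}
    [IsProbabilityMeasure μ] {P : Measure (E m)} [IsProbabilityMeasure P] {X : ℕ → Ω → E m}
    {s : ℕ} (hn : 0 < n) (lam : ℝ) {B : ℝ} (hB : 0 < B) {Y : Fin n → E m} {R : ℝ}
    (hR : ∀ᵐ x ∂P, ∀ j, ‖x - Y j‖ ^ 2 ≤ R)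
    (hXm : ∀ i, AEMeasurable (X i) μ) (hX : ∀ i < s, HasLaw (X i) P μ)
    (hind : iIndepFun (fun i : Fin s => X i) μ) {u : ℕ → (ℕ → E m) → Fin n → ℝ}
    (hu : ∀ i, Measurable (u i)) (hdep : ∀ i, DependsOn (u i) (Set.Iio i)) :
    Integrable (fun ω => ∑ i ∈ Finset.range s, rate n B (i + 1) *
      (h1 lam Y (X i ω) (u i fun k => X k ω) - ∫ y, h1 lam Y y (u i fun k => X k ω) ∂P)) μ ∧
    ∫ ω, |∑ i ∈ Finset.range s, rate n B (i + 1) *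
      (h1 lam Y (X i ω) (u i fun k => X k ω) - ∫ y, h1 lam Y y (u i fun k => X k ω) ∂P)| ∂μ ≤
      √(∑ i ∈ Finset.range s, (rate n B (i + 1) * R) ^ 2) := by
  have hH : Measurable fun g : Fin n → ℝ => ∫ y, h1 lam Y y g ∂P := by
    have h : Measurable (Function.uncurry fun (g : Fin n → ℝ) y => h1 lam Y y g) :=
      measurable_h1 lam Y measurable_snd measurable_fst
    exact (h.stronglyMeasurable.integral_prod_right (ν := P)).measurable
  refine integral_abs_sum_le (P := P) (X := X) (Z := fun i x => rate n B (i + 1) *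
      (h1 lam Y (x i) (u i x) - ∫ y, h1 lam Y y (u i x) ∂P)) (b := fun i => rate n B (i + 1) * R)
    hXm hX hind ?_ ?_ ?_ ?_
  · intro i
    have h2 := measurable_h1 lam Y (measurable_pi_apply i) (hu i)
    exact (h2.sub (hH.comp (hu i))).const_mul _
  · intro i x y hxy
    have h := hdep i (x := x) (y := y) fun j hj => hxy j (Set.mem_Iio.1 hj).le
    beta_reduce
    rw [h, hxy i (Set.mem_Iic.2 le_rfl)]
  · intro i hi
    have hae : ∀ᵐ ω ∂μ, ∀ j, ‖X i ω - Y j‖ ^ 2 ≤ R := by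
      rw [← (hX i hi).map_eq] at hR
      exact ae_of_ae_map (hX i hi).aemeasurable hR
    filter_upwards [hae] with ω hω
    have hr : 0 ≤ rate n B (i + 1) := by unfold rate; positivity
    rw [abs_mul, abs_of_nonneg hr]
    exact mul_le_mul_of_nonneg_left (abs_h1_sub_integral_le hn lam hR _ hω) hr
  · intro i x
    have h : ∀ y, u i (Function.update x i y) = u i x := fun y =>
      hdep i fun j hj => Function.update_of_ne (Set.mem_Iio.1 hj).ne _ _
    simp only [h, Function.update_self]
    rw [integral_const_mul, integral_sub (integrable_h1 hn lam hR _) (integrable_const _)]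
    simp

theorem sum_rate_ge (n : ℕ) {B : ℝ} (hB : 0 < B) (s : ℕ) :
    s * (B * √((n : ℝ) / s)) ≤ ∑ i ∈ Finset.range s, rate n B (i + 1) := by
  have h : ∀ i ∈ Finset.range s, B * √((n : ℝ) / s) ≤ rate n B (i + 1) := by
    intro i hi
    unfold rate
    have : ((i + 1 : ℕ) : ℝ) ≤ s := by exact_mod_cast Finset.mem_range.1 hi
    have h0 : (0 : ℝ) < ((i + 1 : ℕ) : ℝ) := by positivity
    gcongr
  simpa using Finset.card_nsmul_le_sum _ _ _ h

/-- The squared rates form a harmonic sum, which is the source of the logarithm. -/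
theorem sum_rate_sq_le (n : ℕ) (B : ℝ) (s : ℕ) :
    ∑ i ∈ Finset.range s, rate n B (i + 1) ^ 2 ≤ B ^ 2 * n * (1 + Real.log s) := by
  have h := harmonic_le_one_add_log s
  have e : ∑ i ∈ Finset.range s, rate n B (i + 1) ^ 2 = B ^ 2 * n * (harmonic s : ℝ) := by
    rw [harmonic]
    push_cast
    rw [Finset.mul_sum]
    refine Finset.sum_congr rfl fun i _ => ?_
    rw [rate, mul_pow, Real.sq_sqrt (by positivity)]
    push_cast
    ring
  rw [e]
  gcongr

/-- Deterministic comparison of the estimate with the divergence. -/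
theorem abs_sgaEstimate_sub_le (hn : 0 < n) {lam B : ℝ} (hl : 0 < lam) (hB : 0 < B)
    {Y : Fin n → E m} {P : Measure (E m)} [IsProbabilityMeasure P] {R δ L : ℝ}
    {g : Fin n → ℝ} (hg : ∀ j, 0 ≤ g j ∧ g j ≤ R)
    (hweak : ∀ g, ∫ y, h1 lam Y y g ∂P ≤ L) (hL : L ≤ (∫ y, h1 lam Y y g ∂P) + δ)
    {s : ℕ} (hs : 0 < s) (x : ℕ → E m) :
    |sgaEstimate lam B Y 0 s x - L| ≤ δ +
      (|∑ i ∈ Finset.range s, rate n B (i + 1) *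
          (h1 lam Y (x i) (sgaIterate lam B Y 0 x i)
            - ∫ y, h1 lam Y y (sgaIterate lam B Y 0 x i) ∂P)|
        + |∑ i ∈ Finset.range s, rate n B (i + 1) * (h1 lam Y (x i) g - ∫ y, h1 lam Y y g ∂P)|
        + (n * R ^ 2 / 2 + ∑ i ∈ Finset.range s, rate n B (i + 1) ^ 2)) /
        ∑ i ∈ Finset.range s, rate n B (i + 1) := by
  have hn' : (0 : ℝ) < n := by exact_mod_cast hn
  have hr : ∀ i, 0 < rate n B (i + 1) := fun i => by unfold rate; positivity
  have hΓ : 0 < ∑ i ∈ Finset.range s, rate n B (i + 1) :=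
    Finset.sum_pos (fun i _ => hr i) (Finset.nonempty_range_iff.2 hs.ne')
  set Γ := ∑ i ∈ Finset.range s, rate n B (i + 1) with hΓd
  have hδ : 0 ≤ δ := by linarith [hweak g]
  have hreg := regret_le hn hl hB Y x g s
  have hgsq : ∑ j, g j ^ 2 ≤ n * R ^ 2 := by
    have := Finset.sum_le_card_nsmul Finset.univ (fun j => g j ^ 2) (R ^ 2)
      fun j _ => pow_le_pow_left₀ (hg j).1 (hg j).2 2
    simpa using this
  set S := ∑ i ∈ Finset.range s, rate n B (i + 1) *
    h1 lam Y (x i) (sgaIterate lam B Y 0 x i) with hS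
  set M := ∑ i ∈ Finset.range s, rate n B (i + 1) *
          (h1 lam Y (x i) (sgaIterate lam B Y 0 x i)
            - ∫ y, h1 lam Y y (sgaIterate lam B Y 0 x i) ∂P) with hM
  set N := ∑ i ∈ Finset.range s, rate n B (i + 1) *
    (h1 lam Y (x i) g - ∫ y, h1 lam Y y g ∂P) with hN
  set V := ∑ i ∈ Finset.range s, rate n B (i + 1) ^ 2 with hV
  have hV0 : 0 ≤ V := Finset.sum_nonneg fun i _ => sq_nonneg _
  -- From above no regret is needed: by weak duality the mean of `h1` at every iterate is at most
  -- `L`.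
  have hup : S - Γ * L ≤ M := by
    rw [hS, hM, hΓd, Finset.sum_mul, ← Finset.sum_sub_distrib]
    refine Finset.sum_le_sum fun i _ => ?_
    have := mul_le_mul_of_nonneg_left (hweak (sgaIterate lam B Y 0 x i)) (hr i).le
    rw [mul_sub]
    linarith
  -- From below, the iterates compete with the near-optimal `g`. The regret bound concerns sampled
  -- values, so the comparator contributes its own fluctuation `N`.
  have hlow : Γ * (L - δ) - S ≤ (n * R ^ 2 / 2 + V) - N := by
    have e : Γ * (∫ y, h1 lam Y y g ∂P) - S = (∑ i ∈ Finset.range s, rate n B (i + 1) *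
        (h1 lam Y (x i) g - h1 lam Y (x i) (sgaIterate lam B Y 0 x i))) - N := by
      rw [hS, hN, hΓd, Finset.sum_mul, ← Finset.sum_sub_distrib, ← Finset.sum_sub_distrib]
      exact Finset.sum_congr rfl fun i _ => by ring
    have := mul_le_mul_of_nonneg_left hL hΓ.le
    rw [mul_add] at this
    linarith
  have hx : sgaEstimate lam B Y 0 s x = S / Γ := by
    rw [sgaEstimate, one_div, inv_mul_eq_div]
  have e : sgaEstimate lam B Y 0 s x - L = (S - Γ * L) / Γ := by
    rw [hx]; field_simp
  have hA : 0 ≤ n * R ^ 2 / 2 + V := by positivity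
  rw [e, abs_div, abs_of_pos hΓ, div_le_iff₀ hΓ, add_mul, div_mul_cancel₀ _ hΓ.ne', abs_le]
  have h1 := le_abs_self M
  have h2 := neg_abs_le N
  have h3 := abs_nonneg M
  have h4 := abs_nonneg N
  have h5 := mul_nonneg hδ hΓ.le
  constructor <;> nlinarith

/-- The error bound as a function of the number of iterations. -/
theorem error_bound_le {R B δ ℓ q s N Γ V : ℝ} (hR : 0 ≤ R) (hB : 0 < B) (hℓ : 1 ≤ ℓ) (hq : 0 < q)
    (hs : 0 < s) (hN : 1 ≤ N) (hNq : N = s * q ^ 2) (hΓ : s * (B * q) ≤ Γ)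
    (hV : V ≤ B ^ 2 * N * ℓ) :
    δ + (2 * (R * √V) + (N * R ^ 2 / 2 + V)) / Γ ≤
      δ + q * (2 * R * ℓ + (R ^ 2 / (2 * B) + B * ℓ)) := by
  have hΓ0 : 0 < s * (B * q) := by positivity
  -- As `N ℓ ≥ 1`, the square root of `N ℓ` may be replaced by `N ℓ`. This brings the fluctuation to
  -- the form of the regret term, and `N = s q²` then leaves one factor `q`.
  have hsq : √V ≤ B * N * ℓ := by
    refine Real.sqrt_le_iff.2 ⟨by positivity, hV.trans ?_⟩
    have : B ^ 2 * (N * ℓ) * 1 ≤ B ^ 2 * (N * ℓ) * (N * ℓ) := by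
      gcongr
      nlinarith
    nlinarith
  have hnum : 0 ≤ 2 * (R * (B * N * ℓ)) + (N * R ^ 2 / 2 + B ^ 2 * N * ℓ) := by positivity
  gcongr δ + ?_
  calc (2 * (R * √V) + (N * R ^ 2 / 2 + V)) / Γ
      ≤ (2 * (R * (B * N * ℓ)) + (N * R ^ 2 / 2 + B ^ 2 * N * ℓ)) / (s * (B * q)) := by
        gcongr
    _ = q * (2 * R * ℓ + (R ^ 2 / (2 * B) + B * ℓ)) := by
        rw [hNq]
        field_simp

end Error

/-! ### Expected error and the choice of constants. -/

section Final

variable {m n : ℕ}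

theorem integral_abs_sub_le_of_le {Ω : Type*} [MeasurableSpace Ω] {μ : Measure Ω}
    [IsProbabilityMeasure μ] {F M N : Ω → ℝ} {L δ A Γ b : ℝ} (hΓ : 0 < Γ)
    (hF : AEStronglyMeasurable F μ) (hM : Integrable M μ) (hN : Integrable N μ)
    (hMb : ∫ ω, |M ω| ∂μ ≤ b) (hNb : ∫ ω, |N ω| ∂μ ≤ b)
    (h : ∀ ω, |F ω - L| ≤ δ + (|M ω| + |N ω| + A) / Γ) :
    Integrable F μ ∧ ∫ ω, |F ω - L| ∂μ ≤ δ + (2 * b + A) / Γ := by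
  have h1 : Integrable (fun ω => |M ω| + |N ω|) μ := hM.abs.add hN.abs
  have h2 : Integrable (fun ω => |M ω| + |N ω| + A) μ := h1.add (integrable_const A)
  have h3 : Integrable (fun ω => δ + (|M ω| + |N ω| + A) / Γ) μ :=
    (integrable_const δ).add (h2.div_const Γ)
  have hd : Integrable (fun ω => F ω - L) μ :=
    h3.mono' (hF.sub aestronglyMeasurable_const) (Filter.Eventually.of_forall h)
  refine ⟨(hd.add (integrable_const L)).congr
    (Filter.Eventually.of_forall fun ω => sub_add_cancel _ _), ?_⟩
  refine (integral_mono hd.abs h3 h).trans ?_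
  rw [integral_add (integrable_const δ) (h2.div_const Γ), integral_div,
    integral_add h1 (integrable_const A), integral_add hM.abs hN.abs]
  simp only [integral_const, probReal_univ, smul_eq_mul, one_mul]
  gcongr
  linarith

theorem expected_error_le {Ω : Type*} [MeasurableSpace Ω] {μ : Measure Ω} [IsProbabilityMeasure μ]
    {P : Measure (E m)} [IsProbabilityMeasure P] {X : ℕ → Ω → E m} {s : ℕ} (hn : 0 < n)
    {lam B δ R : ℝ} (hl : 0 < lam) (hB : 0 < B) (hδ : 0 < δ) (hR0 : 0 ≤ R) {Y : Fin n → E m}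
    (hR : ∀ᵐ x ∂P, ∀ j, ‖x - Y j‖ ^ 2 ≤ R) (hs : 0 < s)
    (hX : ∀ i < s, HasLaw (X i) P μ) (hind : iIndepFun (fun i : Fin s => X i) μ) :
    ell lam (empirical Y) P ≠ ∞ ∧
    Integrable (fun ω => sgaEstimate lam B Y 0 s fun i => X i ω) μ ∧
    ∫ ω, |sgaEstimate lam B Y 0 s (fun i => X i ω) - (ell lam (empirical Y) P).toReal| ∂μ ≤
      δ + √((n : ℝ) / s) * (2 * R * (1 + Real.log s) +
        (R ^ 2 / (2 * B) + B * (1 + Real.log s))) := by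
  -- Nothing is assumed about the samples with index at least `s`. The estimate ignores them, so
  -- they are replaced by 0 to make the whole sequence measurable.
  wlog hXm : ∀ i, AEMeasurable (X i) μ generalizing X
  · have e : ∀ ω, sgaEstimate lam B Y 0 s (fun i => X i ω) =
        sgaEstimate lam B Y 0 s (fun i => (if i < s then X i else fun _ => 0) ω) := fun ω =>
      dependsOn_sgaEstimate lam B Y 0 s fun i hi => by simp [Set.mem_Iio.1 hi]
    simp only [e]
    refine this (X := fun i => if i < s then X i else fun _ => 0) (fun i hi => ?_) ?_ fun i => ?_
    · simpa [hi] using hX i hi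
    · simpa using hind
    · by_cases hi : i < s
      · simpa [hi] using (hX i hi).aemeasurable
      · simp [hi]
  obtain ⟨g, hg, htop, hL⟩ := exists_ell_le hn hl hδ hR0 hR
  have hweak : ∀ g, ∫ y, h1 lam Y y g ∂P ≤ (ell lam (empirical Y) P).toReal := fun g =>
    (ENNReal.ofReal_le_iff_le_toReal htop).1 (integral_h1_le_ell hn hl hR g)
  obtain ⟨hM, hM'⟩ := integral_abs_sum_h1_sub_le hn lam hB hR hXm hX hind
    (measurable_sgaIterate lam B Y 0) (dependsOn_sgaIterate lam B Y 0)
  obtain ⟨hN, hN'⟩ := integral_abs_sum_h1_sub_le hn lam hB hR hXm hX hind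
    (u := fun _ _ => g) (fun _ => measurable_const) fun _ _ _ _ => rfl
  have hdet := fun ω => abs_sgaEstimate_sub_le hn hl hB hg hweak hL hs fun i => X i ω
  have hmeas : AEStronglyMeasurable (fun ω => sgaEstimate lam B Y 0 s fun i => X i ω) μ :=
    ((measurable_sgaEstimate lam B Y 0 s).comp_aemeasurable
      (aemeasurable_pi_lambda (fun ω i => X i ω) hXm)).aestronglyMeasurable
  set Γ := ∑ i ∈ Finset.range s, rate n B (i + 1) with hΓ
  set V := ∑ i ∈ Finset.range s, rate n B (i + 1) ^ 2 with hV
  have hVR : √(∑ i ∈ Finset.range s, (rate n B (i + 1) * R) ^ 2) = R * √V := by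
    simp only [mul_pow]
    rw [← Finset.sum_mul, mul_comm, Real.sqrt_mul (sq_nonneg R), Real.sqrt_sq hR0]
  rw [hVR] at hM' hN'
  have hn' : (1 : ℝ) ≤ n := by exact_mod_cast hn
  have hs' : (1 : ℝ) ≤ s := by exact_mod_cast hs
  have hΓ0 : 0 < Γ := lt_of_lt_of_le (by positivity) (sum_rate_ge n hB s)
  obtain ⟨hint, hle⟩ := integral_abs_sub_le_of_le hΓ0 hmeas hM hN hM' hN' hdet
  exact ⟨htop, hint, hle.trans (error_bound_le hR0 hB
    (le_add_of_nonneg_right (Real.log_nonneg hs')) (by positivity) (by positivity) hn'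
    (by rw [Real.sq_sqrt (by positivity)]; field_simp) (sum_rate_ge n hB s) (sum_rate_sq_le n B s))⟩

theorem sga_error (D : ℝ) : ∃ C : ℝ, 0 < C ∧
      ∀ (m n : ℕ) (A : Set (RSW.E m)) (Y : Fin n → RSW.E m)
        (P : Measure (RSW.E m)) (lam B ε : ℝ)
        (Ω : Type*) (_ : MeasurableSpace Ω) (μ : Measure Ω) (X : ℕ → Ω → RSW.E m),
        0 ∈ A → (∀ x ∈ A, ∀ y ∈ A, ‖x - y‖ ≤ D) →
        (∀ j, Y j ∈ A) →
        IsProbabilityMeasure P → (∀ᵐ x ∂P, x ∈ A) →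
        0 < lam → 0 < B → (B = D ^ 2 ∨ B = 1) →
        0 < n → 0 < ε → ε ^ 2 ≤ n →
        IsProbabilityMeasure μ →
        (∀ i < RSW.numIter n ε, HasLaw (X i) P μ) →
        iIndepFun (fun i : Fin (RSW.numIter n ε) => X i) μ →
        RSW.ell lam (RSW.empirical Y) P ≠ ∞ ∧
        Integrable (fun ω => RSW.sgaEstimate lam B Y 0 (RSW.numIter n ε) (fun i => X i ω)) μ ∧
        ∫ ω, |RSW.sgaEstimate lam B Y 0 (RSW.numIter n ε) (fun i => X i ω)
              - (RSW.ell lam (RSW.empirical Y) P).toReal| ∂μ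
          ≤ C * ε * (1 + Real.log (n / ε ^ 2)) := by
  -- Contributions, in units of `ε ℓ`: 1 from taking the duality gap `δ = ε`, `4 D²` from the
  -- fluctuations, `D² + D⁴` from the initial distance, `2 (D² + 1)` from the squared rates.
  refine ⟨D ^ 4 + 7 * D ^ 2 + 3, by positivity, ?_⟩
  intro m n A Y P lam B ε Ω _ μ X hA0 hA hY hP hPA hl hB hBD hn hε hεn hμ hX hind
  have hD : 0 ≤ D := by simpa using hA 0 hA0 0 hA0
  have hR : ∀ᵐ x ∂P, ∀ j, ‖x - Y j‖ ^ 2 ≤ D ^ 2 := by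
    filter_upwards [hPA] with x hx j
    exact pow_le_pow_left₀ (norm_nonneg _) (hA x hx _ (hY j)) 2
  have hq : 1 ≤ (n : ℝ) / ε ^ 2 := (one_le_div (by positivity)).2 hεn
  have hs1 : 0 < numIter n ε := Nat.ceil_pos.2 (by linarith)
  have hsl : (n : ℝ) / ε ^ 2 ≤ (numIter n ε : ℕ) := Nat.le_ceil _
  have hsu : ((numIter n ε : ℕ) : ℝ) ≤ 2 * (n / ε ^ 2) := by
    have := (Nat.ceil_lt_add_one (zero_le_one.trans hq)).le
    rw [numIter]
    linarith
  generalize numIter n ε = s at *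
  obtain ⟨h1, h2, h3⟩ := expected_error_le hn hl hB hε (sq_nonneg D) hR hs1 hX hind
  refine ⟨h1, h2, h3.trans ?_⟩
  have hs0 : (0 : ℝ) < s := by exact_mod_cast hs1
  have hsq : √((n : ℝ) / s) ≤ ε := by
    refine Real.sqrt_le_iff.2 ⟨hε.le, ?_⟩
    rw [div_le_iff₀ hs0]
    rw [div_le_iff₀ (by positivity)] at hsl
    linarith
  have hlq : 0 ≤ Real.log (n / ε ^ 2) := Real.log_nonneg hq
  -- Rounding up at most doubles `n / ε²`, and `log 2 < 1`.
  have hls : 1 + Real.log s ≤ 2 * (1 + Real.log (n / ε ^ 2)) := by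
    have h := Real.log_le_log hs0 hsu
    rw [Real.log_mul two_ne_zero (by positivity)] at h
    have := Real.log_two_lt_d9
    linarith
  set ℓ := 1 + Real.log (n / ε ^ 2) with hℓ
  have hℓ1 : 1 ≤ ℓ := by linarith
  have hB1 : B ≤ D ^ 2 + 1 := by
    rcases hBD with h | h <;> nlinarith [sq_nonneg D]
  -- The left side is `D² / 2` when `B = D²` and `D⁴ / 2` when `B = 1`; the sum serves both choices.
  have hB2 : (D ^ 2) ^ 2 / (2 * B) ≤ D ^ 2 + D ^ 4 := by
    rw [div_le_iff₀ (by positivity)]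
    rcases hBD with h | h
    · rw [← h]; nlinarith [pow_nonneg hD 4, sq_nonneg D]
    · rw [h]; nlinarith [pow_nonneg hD 4, sq_nonneg D]
  calc ε + √((n : ℝ) / s) * (2 * D ^ 2 * (1 + Real.log s) +
        ((D ^ 2) ^ 2 / (2 * B) + B * (1 + Real.log s)))
      ≤ ε + ε * (2 * D ^ 2 * (2 * ℓ) + ((D ^ 2 + D ^ 4) + (D ^ 2 + 1) * (2 * ℓ))) := by
        have hlog : 0 ≤ 1 + Real.log s := by
          have := Real.log_nonneg (x := (s : ℝ)) (by exact_mod_cast hs1)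
          linarith
        gcongr
    _ ≤ ε + ε * (2 * D ^ 2 * (2 * ℓ) + ((D ^ 2 + D ^ 4) * ℓ + (D ^ 2 + 1) * (2 * ℓ))) := by
        gcongr
        exact le_mul_of_one_le_right (by positivity) hℓ1
    _ ≤ ε * ℓ + ε * (2 * D ^ 2 * (2 * ℓ) + ((D ^ 2 + D ^ 4) * ℓ + (D ^ 2 + 1) * (2 * ℓ))) := by
        gcongr
        exact le_mul_of_one_le_right hε.le hℓ1
    _ = (D ^ 4 + 7 * D ^ 2 + 3) * ε * ℓ := by ring

end Final

end RSW

theorem mainTheorem7 :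
    -- expected absolute error: the constant depends on `D` only
    (∀ D : ℝ, ∃ C : ℝ, 0 < C ∧
      ∀ (m n : ℕ) (A : Set (RSW.E m)) (Y : Fin n → RSW.E m)
        (P : Measure (RSW.E m)) (lam B ε : ℝ)
        (Ω : Type*) (_ : MeasurableSpace Ω) (μ : Measure Ω) (X : ℕ → Ω → RSW.E m),
        0 ∈ A → (∀ x ∈ A, ∀ y ∈ A, ‖x - y‖ ≤ D) →
        (∀ j, Y j ∈ A) →
        IsProbabilityMeasure P → (∀ᵐ x ∂P, x ∈ A) →
        0 < lam → 0 < B → (B = D ^ 2 ∨ B = 1) →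
        0 < n → 0 < ε → ε ^ 2 ≤ n →
        IsProbabilityMeasure μ →
        (∀ i < RSW.numIter n ε, HasLaw (X i) P μ) →
        iIndepFun (fun i : Fin (RSW.numIter n ε) => X i) μ →
        RSW.ell lam (RSW.empirical Y) P ≠ ∞ ∧
        Integrable (fun ω => RSW.sgaEstimate lam B Y 0 (RSW.numIter n ε) (fun i => X i ω)) μ ∧
        ∫ ω, |RSW.sgaEstimate lam B Y 0 (RSW.numIter n ε) (fun i => X i ω)
              - (RSW.ell lam (RSW.empirical Y) P).toReal| ∂μ
          ≤ C * ε * (1 + Real.log (n / ε ^ 2))) ∧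
    -- running time: one program for all inputs, the constant depends on `m` only
    (∃ prog : RSW.Prog, ∀ m : ℕ, ∃ C : ℝ, 0 < C ∧
      ∀ (n : ℕ) (Y : Fin n → RSW.E m) (x : ℕ → RSW.E m) (lam B ε : ℝ) (σ : RSW.Store),
        0 < lam → 0 < B → 0 < n → 0 < ε → ε ^ 2 ≤ n →
        RSW.HoldsInput σ (RSW.numIter n ε) lam B Y x 0 →
        RSW.HoldsOutput (prog.exec σ).1 (RSW.numIter n ε) lam B Y x 0 ∧
        ((prog.exec σ).2 : ℝ) ≤ C * ((n : ℝ) ^ 2 / ε ^ 2)) := by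
  exact ⟨RSW.sga_error, RSW.Prog.sga, fun m => by
    obtain ⟨C, hC, h⟩ := RSW.Prog.sga_time m
    exact ⟨C, hC, fun n Y x lam B ε σ _ _ => h n Y x lam B ε σ⟩⟩
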